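/- Let $\Omega\subset\mathbb{R}^n$ be a bounded domain with Lipschitz boundary, $T>0$, $\Omega_T=\Omega\times(0,T)$, $m\ge 1$ a real number, and let $p:\overline\Omega\to(1,\infty)$ be log-Hölder continuous with $1<p^-\le p(x)\le p^+<\infty$. Let $D$ denote the weak gradient in $x$, and $$\mathcal V(\Omega)=\{v\in L^2(\Omega): |Dv|^{p(x)}\in L^1(\Omega)\},\qquad \|v\|_{\mathcal V}=\|v\|_{L^2(\Omega)}+\|Dv\|_{L^{p(\cdot)}(\Omega)}$$ (with the Luxemburg norm of $L^{p(\cdot)}$), let $\mathcal V_0(\Omega)$ be the closure of $C_0^\infty(\Omega)$ in $\mathcal V(\Omega)$, and let $$\mathcal U(\Omega_T)=\{u:(0,T)\to\mathcal V(\Omega):\ u\in L^2(\Omega_T),\ |Du|^{p(x)}\in L^1(\Omega_T)\},\qquad \|u\|_{\mathcal U}=\|u\|_{L^2(\Omega_T)}+\|Du\|_{L^{p(\cdot)}(\Omega_T)},$$ with dual space $\mathcal U'(\Omega_T)$. Consider the problem $$\partial_t u=u^m\,\mathrm{div}\big(|Du|^{p(x)-2}Du\big)\ \text{in }\Omega_T,\qquad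 u=0\ \text{on }\partial\Omega\times(0,T),\qquad u(\cdot,0)=u_0\ \text{in }\Omega.$$ A weak solution is a function $u\ge 0$ on $\Omega_T$ such that $u\in\mathcal U(\Omega_T)\cap L^\infty(\Omega_T)$, $\partial_t u\in\mathcal U'(\Omega_T)\cap L^2(\Omega_T)$, $$\iint_{\Omega_T}\partial_t u\,\varphi\,dx\,dt+\iint_{\Omega_T}|Du|^{p(x)-2}Du\cdot D(u^m\varphi)\,dx\,dt=0\qquad\text{for every }\varphi\in C_0^1(\Omega_T),$$ and the boundary and initial conditions hold in the sense of trace, that is, $u(t)\in\mathcal V_0(\Omega)$ for a.e. $t\in(0,T)$, and the representative of $u$ in $C([0,T];L^2(\Omega))$ takes the value $u_0$ at $t=0$. For $f:\Omega\to[0,\infty)$ put $F=\{x\in\Omega: f(x)>0\}$ and let $\operatorname{supp} f$ be the closure in $\Omega$ of $$\Big\{x\in F:\ \lim_{r\to0}\frac{|F\cap B_r(x)|}{|B_r(x)|}\ \text{exists and is}\ >0\Big\}.$$ Let $u_0\ge0$ with $\operatorname{supp}u_0\subsetneqq\Omega$, and let $u$ be any weak solution of the problem. Then $\operatorname{supp}u(t)\subset\operatorname{supp}u_0$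 for a.e. $t\in(0,T]$. -/

import Mathlib

open MeasureTheory Set Filter Topology
open scoped ENNReal NNReal ContDiff

namespace PxParabolic

noncomputable section

/-- The Euclidean space `ℝⁿ`. -/
abbrev E (n : ℕ) : Type := EuclideanSpace ℝ (Fin n)

/-! ### The domain and the exponent -/

/-- Near each of its boundary points, `Ω` is, in suitable orthogonal coordinates, the open region
above the graph of a Lipschitz function. Here `ν` is the vertical unit direction, and
`x - ⟪ν, x⟫ ν` is the projection of `x` to the hyperplane orthogonal to `ν`. -/
def HasLipschitzBoundary {n : ℕ} (Ω : Set (E n)) : Prop :=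
  ∀ x₀ ∈ frontier Ω, ∃ (ν : E n) (γ : E n → ℝ) (K : ℝ≥0) (r : ℝ),
    ‖ν‖ = 1 ∧ LipschitzWith K γ ∧ 0 < r ∧
    ∀ x ∈ Metric.ball x₀ r, x ∈ Ω ↔ γ (x - inner ℝ ν x • ν) < inner ℝ ν x

/-- A bounded domain (open connected nonempty set) with Lipschitz boundary. -/
structure IsBoundedLipschitzDomain {n : ℕ} (Ω : Set (E n)) : Prop where
  isOpen : IsOpen Ω
  isConnected : IsConnected Ω
  isBounded : Bornology.IsBounded Ω
  lipschitz : HasLipschitzBoundary Ω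

/-- `p` is a log-Hölder continuous exponent on `closure Ω` with `1 < p⁻ ≤ p(x) ≤ p⁺ < ∞`. -/
structure IsLogHolderExponent {n : ℕ} (Ω : Set (E n)) (p : E n → ℝ) : Prop where
  logHolder : ∃ C : ℝ, ∀ x ∈ closure Ω, ∀ y ∈ closure Ω,
    |p x - p y| ≤ C / Real.log (Real.exp 1 + 1 / dist x y)
  bounds : ∃ pmin pmax : ℝ, 1 < pmin ∧ ∀ x ∈ closure Ω, pmin ≤ p x ∧ p x ≤ pmax

/-! ### Variable exponent norm -/

/-- The modular `∫ |f|^{q(x)} dμ`. -/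
def modular {X F : Type*} [MeasurableSpace X] [NormedAddCommGroup F]
    (μ : Measure X) (q : X → ℝ) (f : X → F) : ℝ≥0∞ :=
  ∫⁻ x, ‖f x‖ₑ ^ q x ∂μ

/-- The Luxemburg norm `inf {α > 0 | ϱ_q(f / α) ≤ 1}` (equal to `∞` if there is no such `α`). -/
def luxNorm {X F : Type*} [MeasurableSpace X] [NormedAddCommGroup F] [NormedSpace ℝ F]
    (μ : Measure X) (q : X → ℝ) (f : X → F) : ℝ≥0∞ :=
  ⨅ (α : ℝ) (_ : 0 < α ∧ modular μ q (fun x => α⁻¹ • f x) ≤ 1), ENNReal.ofReal α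

/-! ### Weak derivatives and function spaces -/

/-- `φ` is of class `C^k` with compact support in the set `U`. -/
def IsTest {X : Type*} [NormedAddCommGroup X] [NormedSpace ℝ X]
    (k : WithTop ℕ∞) (U : Set X) (φ : X → ℝ) : Prop :=
  ContDiff ℝ k φ ∧ HasCompactSupport φ ∧ tsupport φ ⊆ U

/-- `g` is the weak gradient of `v` on `Ω`. -/
def IsWeakGradient {n : ℕ} (Ω : Set (E n)) (v : E n → ℝ) (g : E n → E n) : Prop :=
  LocallyIntegrableOn v Ω ∧ LocallyIntegrableOn g Ω ∧
  ∀ φ : E n → ℝ, IsTest ∞ Ω φ →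
    ∫ x in Ω, v x • gradient φ x = -∫ x in Ω, φ x • g x

/-- `v ∈ 𝒱(Ω)`, with weak gradient `g`: `v ∈ L²(Ω)` and `|g|^{p(x)} ∈ L¹(Ω)`. -/
def MemV {n : ℕ} (Ω : Set (E n)) (p : E n → ℝ) (v : E n → ℝ) (g : E n → E n) : Prop :=
  MemLp v 2 (volume.restrict Ω) ∧ IsWeakGradient Ω v g ∧
  Integrable (fun x => ‖g x‖ ^ p x) (volume.restrict Ω)

/-- `v ∈ 𝒱₀(Ω)`, with weak gradient `g`: `v` is in the closure of `C₀^∞(Ω)` in `𝒱(Ω)` for the norm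
`‖v‖₂ + ‖Dv‖_{p(·)}`. -/
def MemVZero {n : ℕ} (Ω : Set (E n)) (p : E n → ℝ) (v : E n → ℝ) (g : E n → E n) : Prop :=
  MemV Ω p v g ∧ ∀ ε : ℝ≥0∞, 0 < ε → ∃ φ : E n → ℝ, IsTest ∞ Ω φ ∧
    eLpNorm (fun x => v x - φ x) 2 (volume.restrict Ω)
      + luxNorm (volume.restrict Ω) p (fun x => g x - gradient φ x) < ε

/-- The cylinder `Ω_T = Ω × (0,T)`. -/
def cylinder {n : ℕ} (Ω : Set (E n)) (T : ℝ) : Set (E n × ℝ) := Ω ×ˢ Ioo 0 T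

/-- `G` is the weak gradient of `f` in the space variable on `Ω_T`. -/
def IsSpatialGradient {n : ℕ} (Ω : Set (E n)) (T : ℝ) (f : E n × ℝ → ℝ) (G : E n × ℝ → E n) :
    Prop :=
  AEStronglyMeasurable G (volume.restrict (cylinder Ω T)) ∧
  ∀ᵐ t ∂(volume.restrict (Ioo 0 T)),
    IsWeakGradient Ω (fun x => f (x, t)) (fun x => G (x, t))

/-- `w` is the weak derivative of `f` in the time variable on `Ω_T`. -/
def IsWeakTimeDeriv {n : ℕ} (Ω : Set (E n)) (T : ℝ) (f w : E n × ℝ → ℝ) : Prop :=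
  LocallyIntegrableOn f (cylinder Ω T) ∧ LocallyIntegrableOn w (cylinder Ω T) ∧
  ∀ φ : E n × ℝ → ℝ, IsTest ∞ (cylinder Ω T) φ →
    ∫ z in cylinder Ω T, f z * deriv (fun s => φ (z.1, s)) z.2
      = -∫ z in cylinder Ω T, w z * φ z

/-- `u ∈ 𝒰(Ω_T)`, with spatial weak gradient `G`: `u ∈ L²(Ω_T)`, `u(t) ∈ 𝒱(Ω)` for a.e. `t`, and
`|G|^{p(x)} ∈ L¹(Ω_T)`. -/
def MemU {n : ℕ} (Ω : Set (E n)) (T : ℝ) (p : E n → ℝ) (u : E n × ℝ → ℝ) (G : E n × ℝ → E n) :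
    Prop :=
  MemLp u 2 (volume.restrict (cylinder Ω T)) ∧ IsSpatialGradient Ω T u G ∧
  (∀ᵐ t ∂(volume.restrict (Ioo 0 T)), MemV Ω p (fun x => u (x, t)) (fun x => G (x, t))) ∧
  Integrable (fun z => ‖G z‖ ^ p z.1) (volume.restrict (cylinder Ω T))

/-- `φ ↦ ∬ w φ` is a bounded linear functional on `𝒰(Ω_T)`, for its norm
`‖φ‖₂ + ‖Dφ‖_{p(·)}`. -/
def MemUDual {n : ℕ} (Ω : Set (E n)) (T : ℝ) (p : E n → ℝ) (w : E n × ℝ → ℝ) : Prop :=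
  ∃ C : ℝ≥0, ∀ (φ : E n × ℝ → ℝ) (Φ : E n × ℝ → E n), MemU Ω T p φ Φ →
    Integrable (fun z => w z * φ z) (volume.restrict (cylinder Ω T)) ∧
    ‖∫ z in cylinder Ω T, w z * φ z‖ₑ ≤
      C * (eLpNorm φ 2 (volume.restrict (cylinder Ω T))
        + luxNorm (volume.restrict (cylinder Ω T)) (fun z => p z.1) Φ)

/-! ### Weak solutions -/

/-- `u(·,0) = u₀` in the sense of trace: `u` has a representative in `C([0,T]; L²(Ω))` whose value
at `t = 0` is `u₀`. -/
def HasInitialTrace {n : ℕ} (Ω : Set (E n)) (T : ℝ) (u : E n × ℝ → ℝ) (u₀ : E n → ℝ) : Prop :=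
  ∃ U : ℝ → Lp ℝ 2 (volume.restrict Ω), ContinuousOn U (Icc 0 T) ∧
    (∀ᵐ t ∂(volume.restrict (Ioo 0 T)), U t =ᵐ[volume.restrict Ω] fun x => u (x, t)) ∧
    U 0 =ᵐ[volume.restrict Ω] u₀

/-- `u` is a nonnegative weak solution of `∂ₜu = u^m div(|Du|^{p(x)-2} Du)` in `Ω_T`, `u = 0` on
`∂Ω × (0,T)`, `u(·,0) = u₀`; its weak derivatives are `Du = G` and `∂ₜu = w`. -/
structure IsWeakSolutionWith {n : ℕ} (Ω : Set (E n)) (T : ℝ) (p : E n → ℝ) (m : ℝ)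
    (u₀ : E n → ℝ) (u : E n × ℝ → ℝ) (G : E n × ℝ → E n) (w : E n × ℝ → ℝ) : Prop where
  nonneg : ∀ᵐ z ∂(volume.restrict (cylinder Ω T)), 0 ≤ u z
  memU : MemU Ω T p u G
  memLinfty : MemLp u ∞ (volume.restrict (cylinder Ω T))
  timeDeriv : IsWeakTimeDeriv Ω T u w
  timeDeriv_memUDual : MemUDual Ω T p w
  timeDeriv_memL2 : MemLp w 2 (volume.restrict (cylinder Ω T))
  /-- The weak form; `H` is the weak gradient `D(u^m φ)`. -/
  weakForm : ∀ φ : E n × ℝ → ℝ, IsTest 1 (cylinder Ω T) φ →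
    ∃ H : E n × ℝ → E n, IsSpatialGradient Ω T (fun z => u z ^ m * φ z) H ∧
      (∫ z in cylinder Ω T, w z * φ z)
        + ∫ z in cylinder Ω T, ‖G z‖ ^ (p z.1 - 2) * inner ℝ (G z) (H z) = 0
  /-- Zero lateral boundary values. -/
  lateralTrace : ∀ᵐ t ∂(volume.restrict (Ioo 0 T)),
    MemVZero Ω p (fun x => u (x, t)) (fun x => G (x, t))
  initialTrace : HasInitialTrace Ω T u u₀

/-- `u` is a nonnegative weak solution of the problem with initial datum `u₀`. -/
def IsWeakSolution {n : ℕ} (Ω : Set (E n)) (T : ℝ) (p : E n → ℝ) (m : ℝ)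
    (u₀ : E n → ℝ) (u : E n × ℝ → ℝ) : Prop :=
  ∃ (G : E n × ℝ → E n) (w : E n × ℝ → ℝ), IsWeakSolutionWith Ω T p m u₀ u G w

/-! ### Support -/

/-- The set `F = {x ∈ Ω | f x > 0}`. -/
def posSet {n : ℕ} (Ω : Set (E n)) (f : E n → ℝ) : Set (E n) := {x ∈ Ω | 0 < f x}

/-- The support of a function `f` on `Ω`: the closure, in `Ω`, of the set of all `x ∈ F` at which
the density `lim_{r → 0} |F ∩ B_r(x)| / |B_r(x)|` exists and is positive.

If `supp_Ω` is this set and `supp` is the closure in `ℝⁿ`, then `supp_Ω f = Ω ∩ supp f` and `supp f`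
is the closure of `supp_Ω f`, so `supp f ⊆ supp g ↔ supp_Ω f ⊆ supp_Ω g`, and
`supp f ⊂ Ω` implies `supp_Ω f ⊂ Ω`. -/
def supp {n : ℕ} (Ω : Set (E n)) (f : E n → ℝ) : Set (E n) :=
  Ω ∩ closure {x ∈ posSet Ω f | ∃ l : ℝ≥0∞, 0 < l ∧
    Tendsto (fun r : ℝ => volume (posSet Ω f ∩ Metric.closedBall x r)
      / volume (Metric.closedBall x r)) (𝓝[>] 0) (𝓝 l)}

end

end PxParabolic

/-! Formally, dividing the equation by `u` gives `∂ₜ log u = u^(m-1) div(|Du|^(p-2) Du)`. Testing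
with a cutoff `η ≥ 0` leaves the term `-(m-1) η u^(m-2) |Du|^p`, which is nonpositive because `m ≥
1`, and a term with `Dη` bounded by `M^(m-1) sup|Dη| (1 + |Du|^p)`, where `0 ≤ u ≤ M`. So `∫ η log
u` can increase only by a finite amount. If `η` is supported where `u₀ = 0`, it starts from `-∞` on
`{η > 0}` and stays there, that is, `u(t) = 0` there.

To make this rigorous, `log u` is replaced by `arsinh (N u)`, which vanishes at `u = 0` and tends to
`∞` with `N` where `u > 0`. Its derivative `ψ = arsinhDeriv N` is smooth and bounded and keeps the
two properties of `1/s` that matter: `s ψ(s) ≤ 1` and `s ψ'(s) ≥ -ψ(s)`. This gives a bound for `∫ η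
arsinh (N u(t))` independent of `N` and `t` (`MemVZero.integral_mul_arsinhDeriv_le`,
`IsWeakSolutionWith.exists_integral_arsinh_le`), and Fatou's lemma finishes
(`ae_not_pos_of_integral_arsinh_le`).

Since `η ψ(u)` is not an admissible test function, the equation is first restricted to time slices
(`IsWeakSolutionWith.ae_slice`). On a slice, `u(t)` is approximated by test functions `φ k`, the
slice is tested with `η ψ(φ k)`, and the limit is taken (`MemVZero.exists_approx`,
`MemVZero.integral_test_comp`). In time, `u` is the primitive of `∂ₜu` starting from `u₀`, so the
chain rule for absolutely continuous functions applies (`IsWeakTimeDeriv.ae_eq_add_integral`,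
`ae_comp_sub_eq_integral`).

Supports enter through density points: `u₀` vanishes a.e. on the open set `Ω \ supp u₀`, and a
function that is a.e. nonpositive there has no support in it. -/

namespace PxParabolic

variable {n : ℕ}

/-! ### Product measures -/

section Product

variable {X Y : Type*} [MeasurableSpace X] [MeasurableSpace Y] {μ : Measure X} {ν : Measure Y}

theorem ae_ae_swap_of_ae_prod [SFinite μ] [SFinite ν] {P : X × Y → Prop}
    (h : ∀ᵐ z ∂(μ.prod ν), P z) : ∀ᵐ y ∂ν, ∀ᵐ x ∂μ, P (x, y) := by
  have h' : ∀ᵐ z ∂(ν.prod μ), P z.swap :=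
    (Measure.measurePreserving_swap (μ := ν) (ν := μ)).quasiMeasurePreserving.ae h
  exact Measure.ae_ae_of_ae_prod h'

/-- Fibrewise null sets need not form a product null set without measurability. Here Tonelli is
applied to the measurable function `‖f - g‖`. -/
theorem ae_eq_prod_of_ae_ae_swap [SFinite μ] [SFinite ν] {F : Type*} [NormedAddCommGroup F]
    {f g : X × Y → F} (hf : AEStronglyMeasurable f (μ.prod ν))
    (hg : AEStronglyMeasurable g (μ.prod ν))
    (h : ∀ᵐ y ∂ν, ∀ᵐ x ∂μ, f (x, y) = g (x, y)) : f =ᵐ[μ.prod ν] g := by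
  have hm : AEMeasurable (fun z => ‖f z - g z‖ₑ) (μ.prod ν) := (hf.sub hg).enorm
  have h0 : ∫⁻ z, ‖f z - g z‖ₑ ∂(μ.prod ν) = 0 := by
    rw [lintegral_prod_symm _ hm]
    rw [lintegral_eq_zero_of_ae_eq_zero]
    filter_upwards [h] with y hy
    apply lintegral_eq_zero_of_ae_eq_zero
    filter_upwards [hy] with x hx
    simp [hx]
  rw [lintegral_eq_zero_iff' hm] at h0
  filter_upwards [h0] with z hz
  simpa [sub_eq_zero] using hz

end Product

/-! ### Passing to the limit in integrals of products -/

/-- Split `a k • h k = a k • (h k - h') + a k • h'`: the first part is controlled by the bound on `a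
k`, the second by dominated convergence. -/
theorem tendsto_integral_mul_of_bounded_of_tendsto_L1 {X : Type*} [MeasurableSpace X]
    {μ : Measure X} {F : Type*} [NormedAddCommGroup F] [NormedSpace ℝ F]
    {a : ℕ → X → ℝ} {a' : X → ℝ} {h : ℕ → X → F} {h' : X → F} {C : ℝ}
    (ham : ∀ k, AEStronglyMeasurable (a k) μ) (ha : ∀ k, ∀ᵐ x ∂μ, |a k x| ≤ C)
    (hlim : ∀ᵐ x ∂μ, Tendsto (fun k => a k x) atTop (𝓝 (a' x)))
    (hh : ∀ k, AEStronglyMeasurable (h k) μ) (hh' : Integrable h' μ)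
    (hL : Tendsto (fun k => ∫⁻ x, ‖h k x - h' x‖ₑ ∂μ) atTop (𝓝 0)) :
    Tendsto (fun k => ∫ x, a k x • h k x ∂μ) atTop (𝓝 (∫ x, a' x • h' x ∂μ)) := by
  have hd : ∀ᶠ k in atTop, Integrable (fun x => a k x • (h k x - h' x)) μ := by
    filter_upwards [(tendsto_order.1 hL).2 ⊤ (by simp)] with k hk
    have : Integrable (fun x => h k x - h' x) μ := ⟨(hh k).sub hh'.1, hk⟩
    exact this.bdd_smul C (ham k) (ha k)
  have h1 : Tendsto (fun k => ∫ x, a k x • (h k x - h' x) ∂μ) atTop (𝓝 0) := by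
    rw [tendsto_zero_iff_enorm_tendsto_zero]
    have hb : Tendsto (fun k => ENNReal.ofReal C * ∫⁻ x, ‖h k x - h' x‖ₑ ∂μ) atTop (𝓝 0) := by
      simpa using ENNReal.Tendsto.const_mul hL (Or.inr ENNReal.ofReal_ne_top)
    refine tendsto_of_tendsto_of_tendsto_of_le_of_le tendsto_const_nhds hb
      (fun _ => zero_le) fun k => ?_
    refine (enorm_integral_le_lintegral_enorm _).trans ?_
    rw [← lintegral_const_mul' _ _ ENNReal.ofReal_ne_top]
    refine lintegral_mono_ae ?_
    filter_upwards [ha k] with x hx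
    rw [enorm_smul]
    gcongr
    rw [← ofReal_norm]
    exact ENNReal.ofReal_le_ofReal hx
  have h2 : Tendsto (fun k => ∫ x, a k x • h' x ∂μ) atTop (𝓝 (∫ x, a' x • h' x ∂μ)) := by
    refine tendsto_integral_of_dominated_convergence (fun x => C * ‖h' x‖)
      (fun k => (ham k).smul hh'.1) (hh'.norm.const_mul C) (fun k => ?_) ?_
    · filter_upwards [ha k] with x hx
      rw [norm_smul]
      exact mul_le_mul_of_nonneg_right hx (norm_nonneg _)
    · filter_upwards [hlim] with x hx using hx.smul_const _
  have h3 := h1.add h2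
  rw [zero_add] at h3
  refine h3.congr' ?_
  filter_upwards [hd] with k hk
  have hi : Integrable (fun x => a k x • h' x) μ :=
    hh'.bdd_smul C (ham k) (ha k)
  rw [← integral_add hk hi]
  refine integral_congr_ae (Eventually.of_forall fun x => ?_)
  simp [smul_sub]

/-! ### Functions of one variable -/

/-- Chain rule for the primitive of an integrable function. -/
theorem comp_primitive_sub_eq_integral {w : ℝ → ℝ} {T c t : ℝ} {Ψ ψ : ℝ → ℝ} {K : ℝ≥0}
    (hw : IntervalIntegrable w volume 0 T) (ht : t ∈ Icc 0 T)
    (hΨ : ∀ s, HasDerivAt Ψ (ψ s) s) (hK : LipschitzWith K Ψ) :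
    Ψ (c + ∫ r in 0..t, w r) - Ψ c = ∫ s in 0..t, ψ (c + ∫ r in 0..s, w r) * w s := by
  have hwt : IntervalIntegrable w volume 0 t :=
    hw.mono_set (by rw [uIcc_of_le ht.1, uIcc_of_le (ht.1.trans ht.2)]; exact Icc_subset_Icc_right ht.2)
  have hJ := hwt.absolutelyContinuousOnInterval_intervalIntegral (c := 0) (by simp)
  -- A Lipschitz function of an absolutely continuous one is absolutely continuous. In the proof, `K
  -- + 1` replaces `K` in the denominator because `K` may be `0`.
  have hAC : AbsolutelyContinuousOnInterval (fun s => Ψ (c + ∫ r in 0..s, w r)) 0 t := by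
    rw [absolutelyContinuousOnInterval_iff] at hJ ⊢
    intro ε hε
    obtain ⟨δ, hδ, h⟩ := hJ (ε / (K + 1)) (by positivity)
    refine ⟨δ, hδ, fun I hI hI' => ?_⟩
    have h1 := h I hI hI'
    calc _ ≤ ∑ i ∈ Finset.range I.1,
          K * dist (∫ r in 0..(I.2 i).1, w r) (∫ r in 0..(I.2 i).2, w r) := by
            refine Finset.sum_le_sum fun i _ => ?_
            refine (hK.dist_le_mul _ _).trans_eq ?_
            rw [dist_add_left]
      _ = K * ∑ i ∈ Finset.range I.1,
          dist (∫ r in 0..(I.2 i).1, w r) (∫ r in 0..(I.2 i).2, w r) :=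
            (Finset.mul_sum _ _ _).symm
      _ ≤ K * (ε / (K + 1)) := by gcongr
      _ < (K + 1) * (ε / (K + 1)) := by gcongr; linarith
      _ = ε := by field
  have := hAC.integral_deriv_eq_sub
  simp only [intervalIntegral.integral_same, add_zero] at this
  rw [← this]
  refine intervalIntegral.integral_congr_ae ?_
  filter_upwards [hwt.ae_hasDerivAt_integral] with s hs hs'
  have h1 := hs (uIoc_subset_uIcc hs') 0 (by simp)
  exact ((hΨ _).comp s (h1.const_add c)).deriv

/-- A continuous function with integrable weak derivative `h` is a primitive of `h`. -/
theorem eq_add_integral_of_weakDeriv {g h : ℝ → ℝ} {T : ℝ} (hT : 0 < T)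
    (hg : ContinuousOn g (Icc 0 T)) (hh : IntegrableOn h (Ioo 0 T))
    (hw : ∀ χ : ℝ → ℝ, IsTest ∞ (Ioo 0 T) χ →
      ∫ t in Ioo 0 T, g t * deriv χ t = -∫ t in Ioo 0 T, h t * χ t) :
    ∀ t ∈ Icc 0 T, g t = g 0 + ∫ r in 0..t, h r := by
  have hhi : IntervalIntegrable h volume 0 T := by
    rw [intervalIntegrable_iff_integrableOn_Ioo_of_le hT.le]; exact hh
  have hJ := hhi.absolutelyContinuousOnInterval_intervalIntegral (c := 0) (by simp)
  set J : ℝ → ℝ := fun t => ∫ r in 0..t, h r with hJdef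
  have hJc : ContinuousOn J (Icc 0 T) := by simpa [uIcc_of_le hT.le] using hJ.continuousOn
  have hJw : ∀ χ : ℝ → ℝ, IsTest ∞ (Ioo 0 T) χ →
      ∫ t in Ioo 0 T, J t * deriv χ t = -∫ t in Ioo 0 T, h t * χ t := by
    intro χ hχ
    have hχ1 : ContDiff ℝ 1 χ := hχ.1.of_le (by simp)
    have hz : ∀ t, t ∉ Ioo 0 T → χ t = 0 := fun t ht =>
      image_eq_zero_of_notMem_tsupport fun h => ht (hχ.2.2 h)
    have := hJ.integral_mul_deriv_eq_deriv_mul hχ1.contDiffOn.absolutelyContinuousOnInterval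
    rw [hz 0 (by simp), hz T (by simp)] at this
    rw [← integral_Ioc_eq_integral_Ioo, ← integral_Ioc_eq_integral_Ioo,
      ← intervalIntegral.integral_of_le hT.le, ← intervalIntegral.integral_of_le hT.le, this]
    simp only [mul_zero, sub_self, zero_sub, neg_inj]
    refine intervalIntegral.integral_congr_ae ?_
    filter_upwards [hhi.ae_hasDerivAt_integral] with s hs hs'
    rw [(hs (uIoc_subset_uIcc hs') 0 (by simp)).deriv]
  -- The difference has zero weak derivative; the du Bois-Reymond argument below shows that it is
  -- constant.
  set k : ℝ → ℝ := fun t => g t - J t with hk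
  have hkc : ContinuousOn k (Icc 0 T) := hg.sub hJc
  have hki : IntegrableOn k (Ioo 0 T) :=
    (hkc.integrableOn_Icc).mono_set Ioo_subset_Icc_self
  have bdd_mul : ∀ f : ℝ → ℝ, ContinuousOn f (Icc 0 T) → ∀ χ : ℝ → ℝ, Continuous χ →
      IntegrableOn (fun t => f t * χ t) (Ioo 0 T) := fun f hf χ hχ =>
    ((hf.mul hχ.continuousOn).integrableOn_Icc).mono_set Ioo_subset_Icc_self
  have hkw : ∀ χ : ℝ → ℝ, IsTest ∞ (Ioo 0 T) χ → ∫ t in Ioo 0 T, k t * deriv χ t = 0 := by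
    intro χ hχ
    have hdc : Continuous (deriv χ) := hχ.1.continuous_deriv (by simp)
    simp only [hk, sub_mul]
    rw [integral_sub (bdd_mul g hg _ hdc) (bdd_mul J hJc _ hdc), hw χ hχ, hJw χ hχ, sub_self]
  -- a normalised bump in `(0, T)`
  let b : ContDiffBump (T / 2) := ⟨T / 8, T / 4, by positivity, by linarith⟩
  set ζ₀ : ℝ → ℝ := b.normed volume with hζ₀
  have hζ₀t : IsTest ∞ (Ioo 0 T) ζ₀ := by
    refine ⟨b.contDiff_normed, b.hasCompactSupport_normed, ?_⟩
    rw [b.tsupport_normed_eq, Real.closedBall_eq_Icc]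
    intro x hx
    simp only [b, mem_Icc] at hx
    constructor <;> linarith [hx.1, hx.2]
  have hζ₀i : ∫ t in Ioo 0 T, ζ₀ t = 1 := by
    rw [setIntegral_eq_integral_of_forall_compl_eq_zero, b.integral_normed]
    exact fun t ht => image_eq_zero_of_notMem_tsupport fun h => ht (hζ₀t.2.2 h)
  set c : ℝ := ∫ t in Ioo 0 T, k t * ζ₀ t with hc
  have hconst : ∀ᵐ t, t ∈ Ioo 0 T → k t - c = 0 := by
    refine isOpen_Ioo.ae_eq_zero_of_integral_contDiff_smul_eq_zero
      ((hki.sub (integrable_const c)).locallyIntegrableOn) fun ζ hζ1 hζ2 hζ3 => ?_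
    -- Subtracting `d * ζ₀` makes the mean of `ζ` zero, so that its primitive `χ` has compact
    -- support in `(0, T)` and is an admissible test function.
    set d : ℝ := ∫ t in Ioo 0 T, ζ t with hd
    have hθc : ContDiff ℝ ∞ (fun t => ζ t - d * ζ₀ t) := hζ1.sub (contDiff_const.mul hζ₀t.1)
    set χ : ℝ → ℝ := fun t => ∫ r in 0..t, (ζ r - d * ζ₀ r) with hχ
    have hχd : ∀ t, HasDerivAt χ (ζ t - d * ζ₀ t) t := fun t =>
      (hθc.continuous.integral_hasStrictDerivAt 0 t).hasDerivAt
    have hderiv : deriv χ = fun t => ζ t - d * ζ₀ t := funext fun t => (hχd t).deriv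
    have hχsm : ContDiff ℝ ∞ χ := by
      rw [contDiff_infty_iff_deriv, hderiv]
      exact ⟨fun t => (hχd t).differentiableAt, hθc⟩
    obtain ⟨a, a', haa, hsub⟩ : ∃ a a', (0 < a ∧ a' < T) ∧
        tsupport ζ ∪ tsupport ζ₀ ⊆ Icc a a' := by
      have hK : IsCompact (tsupport ζ ∪ tsupport ζ₀) :=
        hζ2.isCompact.union hζ₀t.2.1.isCompact
      have hKs : tsupport ζ ∪ tsupport ζ₀ ⊆ Ioo 0 T := union_subset hζ3 hζ₀t.2.2
      have hne : (tsupport ζ ∪ tsupport ζ₀).Nonempty := by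
        refine Nonempty.inr ?_
        rw [b.tsupport_normed_eq]
        exact ⟨T / 2, Metric.mem_closedBall_self b.rOut_pos.le⟩
      obtain ⟨a, ha, ha2⟩ := hK.exists_isLeast hne
      obtain ⟨a', ha', ha2'⟩ := hK.exists_isGreatest hne
      exact ⟨a, a', ⟨(hKs ha).1, (hKs ha').2⟩, fun x hx => ⟨ha2 hx, ha2' hx⟩⟩
    have hzero : ∀ r, r ∉ Icc a a' → ζ r - d * ζ₀ r = 0 := by
      intro r hr
      rw [image_eq_zero_of_notMem_tsupport fun h => hr (hsub (Or.inl h)),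
        image_eq_zero_of_notMem_tsupport (f := ζ₀) fun h => hr (hsub (Or.inr h))]
      simp
    have htot : ∫ r in 0..T, (ζ r - d * ζ₀ r) = 0 := by
      rw [intervalIntegral.integral_of_le hT.le, integral_Ioc_eq_integral_Ioo, integral_sub,
        integral_const_mul, hζ₀i, ← hd, mul_one, sub_self]
      · exact (hζ1.continuous.continuousOn.integrableOn_Icc).mono_set Ioo_subset_Icc_self
      · exact ((continuous_const.mul hζ₀t.1.continuous).continuousOn.integrableOn_Icc).mono_set
          Ioo_subset_Icc_self
    have hχz : ∀ t, t ∉ Icc a a' → χ t = 0 := by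
      intro t ht
      rw [mem_Icc, not_and_or, not_le, not_le] at ht
      have hint : ∀ x y : ℝ, IntervalIntegrable (fun r => ζ r - d * ζ₀ r) volume x y :=
        fun x y => hθc.continuous.intervalIntegrable x y
      rcases ht with ht | ht
      · refine intervalIntegral.integral_zero_ae (Eventually.of_forall fun r hr => hzero r ?_)
        intro h
        have := (uIoc_subset_uIcc hr).2
        have h3 : max 0 t < a := max_lt haa.1 ht
        exact absurd h.1 (not_le.2 (this.trans_lt h3))
      · have : χ t = (∫ r in 0..T, (ζ r - d * ζ₀ r)) + ∫ r in T..t, (ζ r - d * ζ₀ r) :=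
          (intervalIntegral.integral_add_adjacent_intervals (hint _ _) (hint _ _)).symm
        rw [this, htot, zero_add]
        refine intervalIntegral.integral_zero_ae (Eventually.of_forall fun r hr => hzero r ?_)
        intro h
        have h2 := (uIoc_subset_uIcc hr).1
        have h3 : a' < min T t := lt_min haa.2 ht
        exact absurd h.2 (not_le.2 (h3.trans_le h2))
    have hsupp : tsupport χ ⊆ Icc a a' :=
      closure_minimal (fun t ht => by by_contra h; exact ht (hχz t h)) isClosed_Icc
    have hχt : IsTest ∞ (Ioo 0 T) χ :=
      ⟨hχsm, HasCompactSupport.of_support_subset_isCompact isCompact_Icc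
        ((subset_tsupport χ).trans hsupp),
        hsupp.trans fun x hx => ⟨haa.1.trans_le hx.1, hx.2.trans_lt haa.2⟩⟩
    have hz := hkw χ hχt
    rw [hderiv] at hz
    have e1 : ∫ t in Ioo 0 T, k t * (ζ t - d * ζ₀ t)
        = (∫ t in Ioo 0 T, k t * ζ t) - d * c := by
      rw [hc, ← integral_const_mul, ← integral_sub (bdd_mul k hkc _ hζ1.continuous)
        ((bdd_mul k hkc _ hζ₀t.1.continuous).const_mul d)]
      congr 1; ext t; ring
    rw [← setIntegral_eq_integral_of_forall_compl_eq_zero (s := Ioo 0 T)]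
    · have e2 : ∫ t in Ioo 0 T, ζ t • (k t - c) = (∫ t in Ioo 0 T, k t * ζ t) - d * c := by
        rw [hd, ← integral_mul_const, ← integral_sub (bdd_mul k hkc _ hζ1.continuous)]
        · congr 1; ext t; simp only [smul_eq_mul]; ring
        · exact ((hζ1.continuous.mul continuous_const).continuousOn.integrableOn_Icc).mono_set
            Ioo_subset_Icc_self
      rw [e2, ← e1, hz]
    · intro t ht
      rw [image_eq_zero_of_notMem_tsupport fun h => ht (hζ3 h), zero_smul]
  -- Continuity upgrades the a.e. equality to all of `[0, T]`, including the endpoint `0` where the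
  -- initial value is read off.
  have hall : EqOn k (fun _ => c) (Icc 0 T) := by
    have h1 : EqOn k (fun _ => c) (Ioo 0 T) := by
      refine Measure.eqOn_open_of_ae_eq (μ := volume) ?_ isOpen_Ioo
        (hkc.mono Ioo_subset_Icc_self) continuousOn_const
      rw [Filter.EventuallyEq, ae_restrict_iff' measurableSet_Ioo]
      filter_upwards [hconst] with t ht ht' using sub_eq_zero.1 (ht ht')
    refine h1.of_subset_closure hkc continuousOn_const Ioo_subset_Icc_self ?_
    rw [closure_Ioo hT.ne]
  intro t ht
  have h1 := hall ht
  have h2 := hall (left_mem_Icc.2 hT.le)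
  simp only [hk, hJdef, intervalIntegral.integral_same] at h1 h2
  linarith

/-! ### Supports -/

/-- Almost every point of a set is a point of density `1` (Besicovitch), so almost all of `{f > 0}`
lies in the support. -/
theorem ae_not_pos_of_notMem_supp (Ω : Set (E n)) (f : E n → ℝ) :
    ∀ᵐ x, x ∈ Ω → x ∉ supp Ω f → ¬ 0 < f x := by
  have h := ae_imp_of_ae_restrict (Besicovitch.ae_tendsto_measure_inter_div volume (posSet Ω f))
  filter_upwards [h] with x hx hxΩ hxs hpos
  exact hxs ⟨hxΩ, subset_closure ⟨⟨hxΩ, hpos⟩, 1, one_pos, hx ⟨hxΩ, hpos⟩⟩⟩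

theorem isOpen_diff_supp {Ω : Set (E n)} (hΩ : IsOpen Ω) (f : E n → ℝ) :
    IsOpen (Ω \ supp Ω f) := by
  rw [supp, sdiff_self_inter]
  exact hΩ.sdiff isClosed_closure

/-- Small balls around a point of the open set `Ω \ supp g` meet `{f > 0}` in a null set, so the
density there is `0` and cannot be positive. -/
theorem supp_subset_supp_of_ae {Ω : Set (E n)} (hΩ : IsOpen Ω) {f g : E n → ℝ}
    (h : ∀ᵐ x, x ∈ Ω \ supp Ω g → ¬ 0 < f x) : supp Ω f ⊆ supp Ω g := by
  rintro x ⟨hxΩ, hx⟩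
  by_contra hxg
  have hW := isOpen_diff_supp hΩ g
  obtain ⟨y, hyW, hyF, l, hl, hlim⟩ := mem_closure_iff.1 hx _ hW ⟨hxΩ, hxg⟩
  obtain ⟨ε, hε, hball⟩ := Metric.isOpen_iff.1 hW y hyW
  have h0 : Tendsto (fun r : ℝ => volume (posSet Ω f ∩ Metric.closedBall y r)
      / volume (Metric.closedBall y r)) (𝓝[>] 0) (𝓝 0) := by
    refine tendsto_const_nhds.congr' ?_
    filter_upwards [Ioo_mem_nhdsGT hε] with r hr
    have : volume (posSet Ω f ∩ Metric.closedBall y r) = 0 := by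
      refine measure_mono_null (fun z hz => ?_) (ae_iff.1 h)
      simp only [mem_ofPred_eq, Classical.not_imp, not_not]
      exact ⟨hball (Metric.closedBall_subset_ball hr.2 hz.2), hz.1.2⟩
    rw [this, ENNReal.zero_div]
  exact hl.ne' (tendsto_nhds_unique hlim h0)

/-! ### Gradients of smooth functions -/

theorem gradient_mul {f g : E n → ℝ} {x : E n} (hf : DifferentiableAt ℝ f x)
    (hg : DifferentiableAt ℝ g x) :
    gradient (fun y => f y * g y) x = f x • gradient g x + g x • gradient f x := by
  simp only [gradient, fderiv_fun_mul hf hg, map_add, map_smul]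

theorem gradient_comp {F : ℝ → ℝ} {F' : ℝ} {f : E n → ℝ} {x : E n} (hF : HasDerivAt F F' (f x))
    (hf : DifferentiableAt ℝ f x) : gradient (fun y => F (f y)) x = F' • gradient f x := by
  have := (hF.comp_hasFDerivAt x hf.hasFDerivAt).fderiv
  simp only [gradient, Function.comp_def] at this ⊢
  rw [this, map_smul]

theorem continuous_gradient {f : E n → ℝ} (hf : ContDiff ℝ 1 f) : Continuous (gradient f) :=
  (LinearIsometryEquiv.continuous _).comp (hf.continuous_fderiv one_ne_zero)

theorem IsTest.contDiff_one {X : Type*} [NormedAddCommGroup X] [NormedSpace ℝ X] {U : Set X}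
    {φ : X → ℝ} (h : IsTest ∞ U φ) : ContDiff ℝ 1 φ := h.1.of_le (by simp)

theorem IsTest.eq_zero {X : Type*} [NormedAddCommGroup X] [NormedSpace ℝ X] {U : Set X}
    {φ : X → ℝ} {k : WithTop ℕ∞} (h : IsTest k U φ) {x : X} (hx : x ∉ U) : φ x = 0 :=
  image_eq_zero_of_notMem_tsupport fun hh => hx (h.2.2 hh)

theorem gradient_eq_zero_of_notMem_tsupport {φ : E n → ℝ} {x : E n} (hx : x ∉ tsupport φ) :
    gradient φ x = 0 := by
  rw [gradient, image_eq_zero_of_notMem_tsupport (f := fderiv ℝ φ)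
    (fun h => hx (tsupport_fderiv_subset ℝ h)), map_zero]

theorem IsTest.gradient_eq_zero {U : Set (E n)} {φ : E n → ℝ} {k : WithTop ℕ∞}
    (h : IsTest k U φ) {x : E n} (hx : x ∉ U) : gradient φ x = 0 :=
  gradient_eq_zero_of_notMem_tsupport fun hh => hx (h.2.2 hh)

theorem hasCompactSupport_gradient {φ : E n → ℝ} (h : HasCompactSupport φ) :
    HasCompactSupport (gradient φ) :=
  HasCompactSupport.of_support_subset_isCompact h.isCompact fun x hx => by
    by_contra hh; exact hx (gradient_eq_zero_of_notMem_tsupport hh)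

theorem IsTest.exists_bound {X : Type*} [NormedAddCommGroup X] [NormedSpace ℝ X] {U : Set X}
    {φ : X → ℝ} (h : IsTest ∞ U φ) : ∃ C, ∀ x, |φ x| ≤ C :=
  h.2.1.exists_bound_of_continuous h.1.continuous

theorem IsTest.exists_gradient_bound {U : Set (E n)} {φ : E n → ℝ} (h : IsTest ∞ U φ) :
    ∃ C, ∀ x, ‖gradient φ x‖ ≤ C :=
  (hasCompactSupport_gradient h.2.1).exists_bound_of_continuous (continuous_gradient h.contDiff_one)

theorem setIntegral_smul_gradient {Ω : Set (E n)} {f ξ : E n → ℝ} (hf : ContDiff ℝ 1 f)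
    (hξ : IsTest ∞ Ω ξ) :
    ∫ x in Ω, f x • gradient ξ x = -∫ x in Ω, ξ x • gradient f x := by
  have hgξ := continuous_gradient hξ.contDiff_one
  have hgf := continuous_gradient hf
  have i1 : Integrable (fun x => f x • gradient ξ x) :=
    (hf.continuous.smul hgξ).integrable_of_hasCompactSupport
      (hasCompactSupport_gradient hξ.2.1).smul_left
  have i2 : Integrable (fun x => ξ x • gradient f x) :=
    (hξ.1.continuous.smul hgf).integrable_of_hasCompactSupport hξ.2.1.smul_right
  have i3 : Integrable (fun x => f x * ξ x) :=
    (hf.continuous.mul hξ.1.continuous).integrable_of_hasCompactSupport hξ.2.1.mul_left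
  rw [setIntegral_eq_integral_of_forall_compl_eq_zero
      (fun x hx => by rw [hξ.gradient_eq_zero hx, smul_zero]),
    setIntegral_eq_integral_of_forall_compl_eq_zero
      (fun x hx => by rw [hξ.eq_zero hx, zero_smul])]
  -- Pairing with a fixed vector reduces the claim to scalar integration by parts in the direction
  -- `v`.
  refine ext_inner_left ℝ fun v => ?_
  rw [inner_neg_right, ← integral_inner i1, ← integral_inner i2]
  have e1 : ∀ x, inner ℝ v (f x • gradient ξ x) = f x * fderiv ℝ ξ x v := fun x => by
    rw [inner_smul_right, inner_gradient_right]; simp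
  have e2 : ∀ x, inner ℝ v (ξ x • gradient f x) = fderiv ℝ f x v * ξ x := fun x => by
    rw [inner_smul_right, inner_gradient_right]; simp [mul_comm]
  have j1 := i1.const_inner (𝕜 := ℝ) v
  have j2 := i2.const_inner (𝕜 := ℝ) v
  simp only [e1, e2] at j1 j2 ⊢
  exact integral_mul_fderiv_eq_neg_fderiv_mul_of_integrable j2 j1 i3
    (fun x _ => hf.differentiable one_ne_zero x)
    (fun x _ => hξ.contDiff_one.differentiable one_ne_zero x)

/-! ### Approximation of functions with zero boundary values -/

/-- The modulus `C / log (e + 1/d)` tends to `0` as `d → 0+`. Continuity serves to make `p`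
measurable on `Ω`. -/
theorem IsLogHolderExponent.continuousOn {Ω : Set (E n)} {p : E n → ℝ}
    (hp : IsLogHolderExponent Ω p) : ContinuousOn p (closure Ω) := by
  obtain ⟨C, hC⟩ := hp.logHolder
  intro x hx
  rw [ContinuousWithinAt, tendsto_iff_dist_tendsto_zero]
  have hlim : Tendsto (fun d : ℝ => C / Real.log (Real.exp 1 + 1 / d)) (𝓝[>] 0) (𝓝 0) := by
    refine Tendsto.div_atTop tendsto_const_nhds (Real.tendsto_log_atTop.comp ?_)
    refine tendsto_atTop_add_const_left _ _ ?_
    exact (tendsto_inv_nhdsGT_zero (𝕜 := ℝ)).congr fun x => (one_div x).symm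
  rw [Metric.tendsto_nhds]
  intro ε hε
  have h1 := hlim.eventually (gt_mem_nhds hε)
  obtain ⟨δ, hδ, h2⟩ := (mem_nhdsGT_iff_exists_Ioo_subset).1 h1
  filter_upwards [inter_mem_nhdsWithin (closure Ω) (Metric.ball_mem_nhds x hδ)] with y hy
  rw [Real.dist_0_eq_abs, abs_dist]
  rcases eq_or_ne y x with rfl | hne
  · simpa using hε
  · rw [Real.dist_eq]
    exact (hC y hy.1 x hx).trans_lt (h2 ⟨dist_pos.2 hne, hy.2⟩)

/-- A form of Young's inequality, obtained by replacing the smaller of `a`, `b` by the larger. Its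
constants do not depend on `q`, which suits a variable exponent. -/
theorem rpow_sub_one_mul_le {a b q : ℝ} (ha : 0 < a) (hb : 0 ≤ b) (hq : 1 ≤ q) :
    a ^ (q - 1) * b ≤ a ^ q + b ^ q := by
  have key : ∀ c : ℝ, 0 < c → c ^ (q - 1) * c = c ^ q := fun c hc => by
    rw [Real.rpow_sub_one hc.ne']; field_simp
  rcases le_total b a with h | h
  · calc a ^ (q - 1) * b ≤ a ^ (q - 1) * a := by gcongr
      _ = a ^ q := key a ha
      _ ≤ _ := le_add_of_nonneg_right (by positivity)
  · calc a ^ (q - 1) * b ≤ b ^ (q - 1) * b := by gcongr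
      _ = b ^ q := key b (ha.trans_le h)
      _ ≤ _ := le_add_of_nonneg_left (by positivity)

theorem one_add_rpow_le {a q Q : ℝ} (ha : 0 ≤ a) (hq : 0 ≤ q) (hQ : q ≤ Q) :
    (1 + a) ^ q ≤ 2 ^ Q * (1 + a ^ q) := by
  have h2 : (2 : ℝ) ^ q ≤ 2 ^ Q := Real.rpow_le_rpow_of_exponent_le (by norm_num) hQ
  have hm : (max 1 a) ^ q ≤ 1 + a ^ q := by
    have : 0 ≤ a ^ q := by positivity
    rcases le_total 1 a with h | h
    · rw [max_eq_right h]; linarith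
    · rw [max_eq_left h, Real.one_rpow]; linarith
  calc (1 + a) ^ q ≤ (2 * max 1 a) ^ q := by
        gcongr; linarith [le_max_left 1 a, le_max_right 1 a]
    _ = 2 ^ q * (max 1 a) ^ q := Real.mul_rpow (by norm_num) (by positivity)
    _ ≤ _ := by gcongr

section Slice

variable {Ω : Set (E n)} {p : E n → ℝ} {v : E n → ℝ} {g : E n → E n}

theorem IsLogHolderExponent.aemeasurable (hΩ : IsOpen Ω) (hp : IsLogHolderExponent Ω p) :
    AEMeasurable p (volume.restrict Ω) :=
  (hp.continuousOn.mono subset_closure).aemeasurable hΩ.measurableSet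

theorem IsLogHolderExponent.exists_bounds (hΩ : IsOpen Ω) (hp : IsLogHolderExponent Ω p) :
    ∃ Q, ∀ᵐ x ∂(volume.restrict Ω), 1 < p x ∧ p x ≤ Q := by
  obtain ⟨q, Q, hq, h⟩ := hp.bounds
  refine ⟨Q, (ae_restrict_iff' hΩ.measurableSet).2 (Eventually.of_forall fun x hx => ?_)⟩
  have := h x (subset_closure hx)
  exact ⟨hq.trans_le this.1, this.2⟩

theorem MemV.aestronglyMeasurable_gradient (h : MemV Ω p v g) :
    AEStronglyMeasurable g (volume.restrict Ω) :=
  h.2.1.2.1.aestronglyMeasurable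

theorem norm_le_one_add_rpow {a q : ℝ} (ha : 0 ≤ a) (hq : 1 ≤ q) : a ≤ 1 + a ^ q := by
  have h0 : 0 ≤ a ^ q := by positivity
  rcases le_total a 1 with h | h
  · linarith
  · have := Real.rpow_le_rpow_of_exponent_le h hq
    rw [Real.rpow_one] at this
    linarith

theorem rpow_sub_one_le_one_add_rpow {a q : ℝ} (ha : 0 ≤ a) (hq : 1 ≤ q) :
    a ^ (q - 1) ≤ 1 + a ^ q := by
  have h0 : 0 ≤ a ^ q := by positivity
  rcases le_total a 1 with h | h
  · linarith [Real.rpow_le_one ha h (sub_nonneg.2 hq)]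
  · linarith [Real.rpow_le_rpow_of_exponent_le h (show q - 1 ≤ q by linarith)]

theorem MemV.integrable_gradient [IsFiniteMeasure (volume.restrict Ω)] (hΩ : IsOpen Ω)
    (hp : IsLogHolderExponent Ω p) (h : MemV Ω p v g) : Integrable g (volume.restrict Ω) := by
  obtain ⟨Q, hQ⟩ := hp.exists_bounds hΩ
  refine Integrable.mono' ((integrable_const (1 : ℝ)).add h.2.2)
    (h.aestronglyMeasurable_gradient) ?_
  filter_upwards [hQ] with x hx
  exact norm_le_one_add_rpow (norm_nonneg _) hx.1.le

theorem norm_rpow_sub_two_mul_inner_le (q : ℝ) (a b : E n) :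
    |‖a‖ ^ (q - 2) * inner ℝ a b| ≤ ‖a‖ ^ (q - 1) * ‖b‖ := by
  rcases eq_or_ne a 0 with rfl | ha
  · simp only [inner_zero_left, mul_zero, abs_zero]; positivity
  have h0 : 0 < ‖a‖ := norm_pos_iff.2 ha
  rw [abs_mul, abs_of_nonneg (by positivity : 0 ≤ ‖a‖ ^ (q - 2))]
  calc ‖a‖ ^ (q - 2) * |inner ℝ a b| ≤ ‖a‖ ^ (q - 2) * (‖a‖ * ‖b‖) := by
        gcongr; exact abs_real_inner_le_norm a b
    _ = ‖a‖ ^ (q - 1) * ‖b‖ := by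
        rw [show q - 1 = (q - 2) + 1 by ring, Real.rpow_add_one h0.ne']; ring

theorem norm_rpow_sub_two_mul_inner_self {q : ℝ} (hq : 1 < q) (a : E n) :
    ‖a‖ ^ (q - 2) * inner ℝ a a = ‖a‖ ^ q := by
  rcases eq_or_ne a 0 with rfl | ha
  · simp [Real.zero_rpow (by linarith : q ≠ 0)]
  have h0 : 0 < ‖a‖ := norm_pos_iff.2 ha
  rw [real_inner_self_eq_norm_sq, ← Real.rpow_natCast, ← Real.rpow_add h0]
  norm_num

/-- Takes the place of Hölder's inequality: write `‖h‖ = α ‖α⁻¹ h‖` and apply `rpow_sub_one_mul_le`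
pointwise. The weight uses `1 + ‖g‖` since this is at least `1`, so that the bound controls both
`‖h‖` and `‖g‖^(p-1) ‖h‖` in `L¹`. -/
theorem lintegral_weight_mul_le {h : E n → E n} {α : ℝ} (hα : 0 < α)
    (hg : AEMeasurable (fun x => ENNReal.ofReal ((1 + ‖g x‖) ^ p x)) (volume.restrict Ω))
    (hp1 : ∀ᵐ x ∂(volume.restrict Ω), 1 < p x)
    (hmod : modular (volume.restrict Ω) p (fun x => α⁻¹ • h x) ≤ 1) :
    ∫⁻ x in Ω, ENNReal.ofReal ((1 + ‖g x‖) ^ (p x - 1)) * ‖h x‖ₑ ≤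
      ENNReal.ofReal α * ((∫⁻ x in Ω, ENNReal.ofReal ((1 + ‖g x‖) ^ p x)) + 1) := by
  calc ∫⁻ x in Ω, ENNReal.ofReal ((1 + ‖g x‖) ^ (p x - 1)) * ‖h x‖ₑ
      ≤ ∫⁻ x in Ω, ENNReal.ofReal α *
          (ENNReal.ofReal ((1 + ‖g x‖) ^ p x) + ‖α⁻¹ • h x‖ₑ ^ p x) := by
        refine lintegral_mono_ae ?_
        filter_upwards [hp1] with x hx
        have e1 : ‖h x‖ₑ = ENNReal.ofReal (α * ‖α⁻¹ • h x‖) := by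
          rw [norm_smul, Real.norm_of_nonneg (inv_pos.2 hα).le, ← mul_assoc,
            mul_inv_cancel₀ hα.ne', one_mul, ofReal_norm]
        have e2 : ‖α⁻¹ • h x‖ₑ ^ p x = ENNReal.ofReal (‖α⁻¹ • h x‖ ^ p x) := by
          rw [← ofReal_norm, ENNReal.ofReal_rpow_of_nonneg (norm_nonneg _) (by linarith)]
        rw [e1, e2, ← ENNReal.ofReal_add (by positivity) (by positivity),
          ← ENNReal.ofReal_mul (by positivity), ← ENNReal.ofReal_mul hα.le]
        refine ENNReal.ofReal_le_ofReal ?_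
        have := rpow_sub_one_mul_le (a := 1 + ‖g x‖) (b := ‖α⁻¹ • h x‖) (q := p x)
          (by positivity) (norm_nonneg _) hx.le
        calc _ = α * ((1 + ‖g x‖) ^ (p x - 1) * ‖α⁻¹ • h x‖) := by ring
          _ ≤ _ := by gcongr
    _ = ENNReal.ofReal α * ((∫⁻ x in Ω, ENNReal.ofReal ((1 + ‖g x‖) ^ p x)) +
          ∫⁻ x in Ω, ‖α⁻¹ • h x‖ₑ ^ p x) := by
        rw [lintegral_const_mul' _ _ ENNReal.ofReal_ne_top, lintegral_add_left' hg]
    _ ≤ _ := by gcongr; exact hmod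

/-- A function with zero boundary values is approximated by test functions almost everywhere and
in `L¹`, with gradients converging in `L¹` and in `L¹` with the weight `|g|^{p-2} g`. -/
theorem MemVZero.exists_approx [IsFiniteMeasure (volume.restrict Ω)] (hΩ : IsOpen Ω)
    (hp : IsLogHolderExponent Ω p) (h : MemVZero Ω p v g) :
    ∃ φ : ℕ → E n → ℝ, (∀ k, IsTest ∞ Ω (φ k)) ∧
      (∀ᵐ x ∂(volume.restrict Ω), Tendsto (fun k => φ k x) atTop (𝓝 (v x))) ∧
      Tendsto (fun k => ∫⁻ x in Ω, ‖φ k x - v x‖ₑ) atTop (𝓝 0) ∧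
      Tendsto (fun k => ∫⁻ x in Ω, ‖gradient (φ k) x - g x‖ₑ) atTop (𝓝 0) ∧
      Tendsto (fun k => ∫⁻ x in Ω, ‖‖g x‖ ^ (p x - 2) * inner ℝ (g x) (gradient (φ k) x)
        - ‖g x‖ ^ p x‖ₑ) atTop (𝓝 0) := by
  obtain ⟨Q, hQ⟩ := hp.exists_bounds hΩ
  have hgm := h.1.aestronglyMeasurable_gradient
  have hpm := hp.aemeasurable hΩ
  have hW : AEMeasurable (fun x => ENNReal.ofReal ((1 + ‖g x‖) ^ p x)) (volume.restrict Ω) :=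
    ((hgm.norm.aemeasurable.const_add 1).pow hpm).ennreal_ofReal
  set I : ℝ≥0∞ := ∫⁻ x in Ω, ENNReal.ofReal ((1 + ‖g x‖) ^ p x) with hI
  have hIfin : I + 1 ≠ ⊤ := by
    refine ENNReal.add_ne_top.2 ⟨?_, ENNReal.one_ne_top⟩
    have hint : Integrable (fun x => 2 ^ Q * (1 + ‖g x‖ ^ p x)) (volume.restrict Ω) :=
      ((integrable_const (1 : ℝ)).add h.1.2.2).const_mul _
    refine ((lintegral_mono_ae ?_).trans_lt hint.lintegral_lt_top).ne
    filter_upwards [hQ] with x hx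
    exact ENNReal.ofReal_le_ofReal (one_add_rpow_le (norm_nonneg _) (by linarith) hx.2)
  have hε : ∀ k : ℕ, (0 : ℝ≥0∞) < ((k : ℝ≥0∞) + 1)⁻¹ := fun k => by simp
  choose φ hφ hφε using fun k : ℕ => h.2 _ (hε k)
  have hlim : Tendsto (fun k : ℕ => ((k : ℝ≥0∞) + 1)⁻¹) atTop (𝓝 0) := by
    have := (tendsto_add_atTop_iff_nat 1).2 ENNReal.tendsto_inv_nat_nhds_zero
    simpa using this
  have hL2 : Tendsto (fun k => eLpNorm (φ k - v) 2 (volume.restrict Ω)) atTop (𝓝 0) := by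
    refine tendsto_of_tendsto_of_tendsto_of_le_of_le tendsto_const_nhds hlim
      (fun _ => zero_le) fun k => ?_
    rw [eLpNorm_sub_comm]
    exact le_self_add.trans (hφε k).le
  have hweight : Tendsto (fun k => ∫⁻ x in Ω, ENNReal.ofReal ((1 + ‖g x‖) ^ (p x - 1)) *
      ‖gradient (φ k) x - g x‖ₑ) atTop (𝓝 0) := by
    have hb : Tendsto (fun k : ℕ => ((k : ℝ≥0∞) + 1)⁻¹ * (I + 1)) atTop (𝓝 0) := by
      simpa using ENNReal.Tendsto.mul_const hlim (Or.inr hIfin)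
    refine tendsto_of_tendsto_of_tendsto_of_le_of_le tendsto_const_nhds hb
      (fun _ => zero_le) fun k => ?_
    -- A Luxemburg norm below `1/(k+1)` provides some `α < 1/(k+1)` at which the modular is at most
    -- `1`.
    have hk := (le_add_self).trans_lt (hφε k)
    simp only [luxNorm, iInf_lt_iff] at hk
    obtain ⟨α, ⟨hα, hmod⟩, hαk⟩ := hk
    have := lintegral_weight_mul_le hα hW (hQ.mono fun x hx => hx.1) hmod
    simp only [enorm_sub_rev] at this ⊢
    exact this.trans (by gcongr)
  have hmeas : ∀ k, AEStronglyMeasurable (φ k) (volume.restrict Ω) := fun k =>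
    (hφ k).1.continuous.aestronglyMeasurable
  -- Convergence in `L²` gives convergence a.e. only along a subsequence `ns`; the other limits are
  -- inherited by it.
  have hinM := tendstoInMeasure_of_tendsto_eLpNorm two_ne_zero hmeas
    h.1.1.aestronglyMeasurable hL2
  obtain ⟨ns, hns, hae⟩ := hinM.exists_seq_tendsto_ae
  refine ⟨fun k => φ (ns k), fun k => hφ _, hae, ?_, ?_, ?_⟩
  · refine Tendsto.comp (g := fun k => ∫⁻ x in Ω, ‖φ k x - v x‖ₑ) ?_ hns.tendsto_atTop
    set c : ℝ≥0∞ := (volume.restrict Ω) univ ^ (1 / (1 : ℝ≥0∞).toReal - 1 / (2 : ℝ≥0∞).toReal)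
      with hc
    have hcfin : c ≠ ⊤ := ENNReal.rpow_ne_top_of_nonneg (by norm_num) (measure_ne_top _ _)
    have hb : Tendsto (fun k => eLpNorm (φ k - v) 2 (volume.restrict Ω) * c) atTop (𝓝 0) := by
      simpa using ENNReal.Tendsto.mul_const hL2 (Or.inr hcfin)
    refine tendsto_of_tendsto_of_tendsto_of_le_of_le tendsto_const_nhds hb
      (fun _ => zero_le) fun k => ?_
    have := eLpNorm_le_eLpNorm_mul_rpow_measure_univ (p := 1) (q := 2) (by norm_num)
      ((hmeas k).sub h.1.1.aestronglyMeasurable)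
    rwa [eLpNorm_one_eq_lintegral_enorm] at this
  · refine Tendsto.comp (g := fun k => ∫⁻ x in Ω, ‖gradient (φ k) x - g x‖ₑ) ?_ hns.tendsto_atTop
    refine tendsto_of_tendsto_of_tendsto_of_le_of_le tendsto_const_nhds hweight
      (fun _ => zero_le) fun k => lintegral_mono_ae ?_
    filter_upwards [hQ] with x hx
    refine le_mul_of_one_le_left zero_le ?_
    rw [ENNReal.one_le_ofReal]
    exact Real.one_le_rpow (by linarith [norm_nonneg (g x)]) (by linarith)
  · refine Tendsto.comp (g := fun k => ∫⁻ x in Ω, ‖‖g x‖ ^ (p x - 2) *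
      inner ℝ (g x) (gradient (φ k) x) - ‖g x‖ ^ p x‖ₑ) ?_ hns.tendsto_atTop
    refine tendsto_of_tendsto_of_tendsto_of_le_of_le tendsto_const_nhds hweight
      (fun _ => zero_le) fun k => lintegral_mono_ae ?_
    filter_upwards [hQ] with x hx
    rw [← norm_rpow_sub_two_mul_inner_self hx.1 (g x), ← mul_sub, ← inner_sub_right,
      ← ofReal_norm, ← ofReal_norm, ← ENNReal.ofReal_mul (by positivity)]
    refine ENNReal.ofReal_le_ofReal ((norm_rpow_sub_two_mul_inner_le _ _ _).trans ?_)
    gcongr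
    · linarith
    · linarith

end Slice

/-! ### Chain rule and uniqueness for weak gradients -/

section ChainRule

variable {Ω : Set (E n)} {p : E n → ℝ} {v : E n → ℝ} {g : E n → E n}

theorem tendsto_integral_of_norm_sub_le {X F F' : Type*} [MeasurableSpace X] {μ : Measure X}
    [NormedAddCommGroup F] [NormedSpace ℝ F] [NormedAddCommGroup F']
    {h : ℕ → X → F} {h' : X → F} {φ : ℕ → X → F'} {v : X → F'} {C : ℝ}
    (hh : ∀ k, Integrable (h k) μ) (hh' : AEStronglyMeasurable h' μ)
    (hle : ∀ k x, ‖h k x - h' x‖ ≤ C * ‖φ k x - v x‖)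
    (hφ : Tendsto (fun k => ∫⁻ x, ‖φ k x - v x‖ₑ ∂μ) atTop (𝓝 0)) :
    Tendsto (fun k => ∫ x, h k x ∂μ) atTop (𝓝 (∫ x, h' x ∂μ)) := by
  have hL : Tendsto (fun k => ∫⁻ x, ‖h k x - h' x‖ₑ ∂μ) atTop (𝓝 0) := by
    have hb : Tendsto (fun k => ENNReal.ofReal |C| * ∫⁻ x, ‖φ k x - v x‖ₑ ∂μ) atTop (𝓝 0) := by
      simpa using ENNReal.Tendsto.const_mul hφ (Or.inr ENNReal.ofReal_ne_top)
    refine tendsto_of_tendsto_of_tendsto_of_le_of_le tendsto_const_nhds hb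
      (fun _ => zero_le) fun k => ?_
    rw [← lintegral_const_mul' _ _ ENNReal.ofReal_ne_top]
    refine lintegral_mono fun x => ?_
    rw [← ofReal_norm, ← ofReal_norm, ← ENNReal.ofReal_mul (abs_nonneg _)]
    exact ENNReal.ofReal_le_ofReal ((hle k x).trans (by gcongr; exact le_abs_self C))
  obtain ⟨k, hk⟩ := ((tendsto_order.1 hL).2 ⊤ (by simp)).exists
  have hi : Integrable h' μ := by
    have h1 : Integrable (fun x => h k x - h' x) μ := ⟨(hh k).1.sub hh', hk⟩
    exact ((hh k).sub h1).congr (Eventually.of_forall fun x => by simp)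
  exact tendsto_integral_of_L1 _ hi.1 (Eventually.of_forall hh) hL

theorem MemV.integrable [IsFiniteMeasure (volume.restrict Ω)] (h : MemV Ω p v g) :
    Integrable v (volume.restrict Ω) :=
  h.1.integrable (by norm_num)

theorem integrable_comp_of_lipschitzWith [IsFiniteMeasure (volume.restrict Ω)]
    (hv : Integrable v (volume.restrict Ω)) {F : ℝ → ℝ} {L : ℝ≥0} (hF : LipschitzWith L F) :
    Integrable (fun x => F (v x)) (volume.restrict Ω) := by
  refine Integrable.mono' ((integrable_const |F 0|).add (hv.norm.const_mul L))
    (hF.continuous.comp_aestronglyMeasurable hv.1) (Eventually.of_forall fun x => ?_)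
  have := hF.dist_le_mul (v x) 0
  rw [Real.dist_eq, dist_zero_right] at this
  have h2 := abs_add_le (F (v x) - F 0) (F 0)
  rw [sub_add_cancel] at h2
  simp only [Pi.add_apply, Real.norm_eq_abs] at this ⊢
  linarith

theorem integrable_smul_of_hasCompactSupport {a : E n → ℝ} {V : E n → E n} (ha : Continuous a)
    (hV : Continuous V) (hs : HasCompactSupport V) :
    Integrable (fun x => a x • V x) (volume.restrict Ω) :=
  ((ha.smul hV).integrable_of_hasCompactSupport hs.smul_left).restrict

/-- For a test function in place of `v` this is classical integration by parts, and the approximants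
from `MemVZero.exists_approx` carry it over. Terms with `F` pass to the limit by the Lipschitz
bound. As `F'` is merely continuous and bounded, the remaining term combines a.e. convergence of `F'
(φ k)` with `L¹` convergence of the gradients. -/
theorem MemVZero.setIntegral_comp_mul_smul_gradient [IsFiniteMeasure (volume.restrict Ω)]
    (hΩ : IsOpen Ω) (hp : IsLogHolderExponent Ω p) (h : MemVZero Ω p v g) {F F' : ℝ → ℝ} {L : ℝ≥0}
    (hF : ∀ s, HasDerivAt F (F' s) s) (hF' : Continuous F') (hL : ∀ s, |F' s| ≤ L)
    {θ ξ : E n → ℝ} (hθ : IsTest ∞ Ω θ) (hξ : IsTest ∞ Ω ξ) :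
    ∫ x in Ω, (F (v x) * θ x) • gradient ξ x =
      -∫ x in Ω, ξ x • ((θ x * F' (v x)) • g x + F (v x) • gradient θ x) := by
  have hderiv : deriv F = F' := funext fun s => (hF s).deriv
  have hFd : Differentiable ℝ F := fun s => (hF s).differentiableAt
  have hF1 : ContDiff ℝ 1 F := by
    rw [contDiff_one_iff_deriv, hderiv]; exact ⟨hFd, hF'⟩
  have hlip : LipschitzWith L F := lipschitzWith_of_nnnorm_deriv_le hFd fun s => by
    rw [hderiv]; exact hL s
  obtain ⟨φ, hφ, hae, hL1, hgr, -⟩ := h.exists_approx hΩ hp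
  obtain ⟨Cθ, hCθ⟩ := hθ.exists_bound
  obtain ⟨Cξ, hCξ⟩ := hξ.exists_bound
  obtain ⟨Dθ, hDθ⟩ := hθ.exists_gradient_bound
  obtain ⟨Dξ, hDξ⟩ := hξ.exists_gradient_bound
  have hcθ := hθ.1.continuous
  have hcξ := hξ.1.continuous
  have hgθ := continuous_gradient hθ.contDiff_one
  have hgξ := continuous_gradient hξ.contDiff_one
  have hvm : AEStronglyMeasurable v (volume.restrict Ω) := h.1.1.aestronglyMeasurable
  have hFv : AEStronglyMeasurable (fun x => F (v x)) (volume.restrict Ω) :=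
    hF1.continuous.comp_aestronglyMeasurable hvm
  have hFφ : ∀ k, Continuous fun x => F (φ k x) := fun k =>
    hF1.continuous.comp (hφ k).1.continuous
  have hdist : ∀ k x, |F (φ k x) - F (v x)| ≤ L * ‖φ k x - v x‖ := fun k x => by
    have := hlip.dist_le_mul (φ k x) (v x)
    rwa [Real.dist_eq, dist_eq_norm] at this
  have lim1 : Tendsto (fun k => ∫ x in Ω, (F (φ k x) * θ x) • gradient ξ x) atTop
      (𝓝 (∫ x in Ω, (F (v x) * θ x) • gradient ξ x)) := by
    refine tendsto_integral_of_norm_sub_le (C := L * (Cθ * Dξ)) (φ := φ) (v := v) (fun k => ?_)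
      ((hFv.mul hcθ.aestronglyMeasurable).smul hgξ.aestronglyMeasurable) (fun k x => ?_) hL1
    · exact integrable_smul_of_hasCompactSupport ((hFφ k).mul hcθ) hgξ
        (hasCompactSupport_gradient hξ.2.1)
    · rw [← sub_smul, ← sub_mul, norm_smul, norm_mul, Real.norm_eq_abs, Real.norm_eq_abs]
      calc |F (φ k x) - F (v x)| * |θ x| * ‖gradient ξ x‖
          ≤ (L * ‖φ k x - v x‖) * Cθ * Dξ := by
            gcongr
            · exact mul_nonneg (by positivity) ((abs_nonneg _).trans (hCθ x))
            · exact hdist k x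
            · exact hCθ x
            · exact hDξ x
        _ = _ := by ring
  have lim2 : Tendsto (fun k => ∫ x in Ω, (ξ x * F (φ k x)) • gradient θ x) atTop
      (𝓝 (∫ x in Ω, (ξ x * F (v x)) • gradient θ x)) := by
    refine tendsto_integral_of_norm_sub_le (C := L * (Cξ * Dθ)) (φ := φ) (v := v) (fun k => ?_)
      ((hcξ.aestronglyMeasurable.mul hFv).smul hgθ.aestronglyMeasurable) (fun k x => ?_) hL1
    · exact integrable_smul_of_hasCompactSupport (hcξ.mul (hFφ k)) hgθ
        (hasCompactSupport_gradient hθ.2.1)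
    · rw [← sub_smul, ← mul_sub, norm_smul, norm_mul, Real.norm_eq_abs, Real.norm_eq_abs]
      calc |ξ x| * |F (φ k x) - F (v x)| * ‖gradient θ x‖
          ≤ Cξ * (L * ‖φ k x - v x‖) * Dθ := by
            have h0 : 0 ≤ Cξ := (abs_nonneg _).trans (hCξ x)
            gcongr
            · exact hCξ x
            · exact hdist k x
            · exact hDθ x
        _ = _ := by ring
  have hbd : ∀ s x, |ξ x * θ x * F' s| ≤ Cξ * Cθ * L := fun s x => by
    have h0 : 0 ≤ Cξ := (abs_nonneg _).trans (hCξ x)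
    have h1 : 0 ≤ Cθ := (abs_nonneg _).trans (hCθ x)
    rw [abs_mul, abs_mul]
    gcongr
    · exact hCξ x
    · exact hCθ x
    · exact hL s
  have lim3 : Tendsto (fun k => ∫ x in Ω, (ξ x * θ x * F' (φ k x)) • gradient (φ k) x) atTop
      (𝓝 (∫ x in Ω, (ξ x * θ x * F' (v x)) • g x)) := by
    refine tendsto_integral_mul_of_bounded_of_tendsto_L1 (C := Cξ * Cθ * L) (fun k => ?_)
      (fun k => Eventually.of_forall fun x => hbd _ x) ?_ (fun k => ?_) (h.1.integrable_gradient hΩ hp) hgr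
    · exact ((hcξ.mul hcθ).mul (hF'.comp (hφ k).1.continuous)).aestronglyMeasurable
    · filter_upwards [hae] with x hx
      exact ((hF'.tendsto _).comp hx).const_mul _
    · exact (continuous_gradient (hφ k).contDiff_one).aestronglyMeasurable
  have hk : ∀ k, ∫ x in Ω, (F (φ k x) * θ x) • gradient ξ x =
      -((∫ x in Ω, (ξ x * θ x * F' (φ k x)) • gradient (φ k) x) +
        ∫ x in Ω, (ξ x * F (φ k x)) • gradient θ x) := by
    intro k
    have hgφ := continuous_gradient (hφ k).contDiff_one
    have hcd : ContDiff ℝ 1 fun x => F (φ k x) * θ x :=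
      (hF1.comp (hφ k).contDiff_one).mul hθ.contDiff_one
    rw [setIntegral_smul_gradient hcd hξ, ← integral_add]
    · congr 2
      ext1 x
      have e := gradient_mul (x := x) ((hF1.comp (hφ k).contDiff_one).differentiable one_ne_zero x)
        (hθ.contDiff_one.differentiable one_ne_zero x)
      have e2 := gradient_comp (hF (φ k x)) ((hφ k).contDiff_one.differentiable one_ne_zero x)
      simp only [Function.comp_def] at e ⊢
      rw [e, e2, smul_add, smul_smul, smul_smul, smul_smul, add_comm]
    · exact integrable_smul_of_hasCompactSupport
        ((hcξ.mul hcθ).mul (hF'.comp (hφ k).1.continuous)) hgφ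
        (hasCompactSupport_gradient (hφ k).2.1)
    · exact integrable_smul_of_hasCompactSupport (hcξ.mul (hFφ k)) hgθ
        (hasCompactSupport_gradient hθ.2.1)
  have lim4 := (lim3.add lim2).neg
  simp only [← hk] at lim4
  rw [tendsto_nhds_unique lim1 lim4, ← integral_add]
  · congr 2
    ext1 x
    rw [smul_add, smul_smul, smul_smul, mul_assoc]
  · refine (h.1.integrable_gradient hΩ hp).bdd_smul (φ := fun x => ξ x * θ x * F' (v x))
      (Cξ * Cθ * L) ?_ (Eventually.of_forall fun x => hbd _ x)
    exact (hcξ.mul hcθ).aestronglyMeasurable.mul (hF'.comp_aestronglyMeasurable hvm)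
  · have hi : Integrable (fun x => F (v x)) (volume.restrict Ω) :=
      integrable_comp_of_lipschitzWith h.1.integrable hlip
    have hi2 : Integrable (fun x => ξ x * F (v x)) (volume.restrict Ω) :=
      hi.bdd_mul (c := Cξ) hcξ.aestronglyMeasurable (Eventually.of_forall hCξ)
    exact hi2.smul_bdd Dθ hgθ.aestronglyMeasurable (Eventually.of_forall hDθ)

theorem IsWeakGradient.ae_eq_of_integral_eq (hΩ : IsOpen Ω) {f : E n → ℝ} {H K : E n → E n}
    (hH : IsWeakGradient Ω f H) (hK : LocallyIntegrableOn K Ω)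
    (h : ∀ ξ, IsTest ∞ Ω ξ → ∫ x in Ω, f x • gradient ξ x = -∫ x in Ω, ξ x • K x) :
    H =ᵐ[volume.restrict Ω] K := by
  have hz := hΩ.ae_eq_zero_of_integral_contDiff_smul_eq_zero (hH.2.1.sub hK)
    (fun ξ h1 h2 h3 => ?_)
  · rw [EventuallyEq, ae_restrict_iff' hΩ.measurableSet]
    filter_upwards [hz] with x hx hxΩ using sub_eq_zero.1 (hx hxΩ)
  · have hξ : IsTest ∞ Ω ξ := ⟨h1, h2, h3⟩
    have e := (hH.2.2 ξ hξ).symm.trans (h ξ hξ)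
    rw [neg_inj] at e
    have int : ∀ {G : E n → E n}, LocallyIntegrableOn G Ω →
        Integrable (fun x => ξ x • G x) (volume.restrict Ω) := fun {G} hG => by
      obtain ⟨C, hC⟩ := hξ.exists_bound
      have h4 : IntegrableOn (fun x => ξ x • G x) (tsupport ξ) :=
        (hG.integrableOn_compact_subset h3 h2.isCompact).bdd_smul C
          h1.continuous.aestronglyMeasurable (Eventually.of_forall hC)
      exact (h4.integrable_of_forall_notMem_eq_zero fun x hx => by
        rw [image_eq_zero_of_notMem_tsupport hx, zero_smul]).restrict
    rw [← setIntegral_eq_integral_of_forall_compl_eq_zero (s := Ω)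
      (fun x hx => by rw [hξ.eq_zero hx, zero_smul])]
    simp only [Pi.sub_apply, smul_sub]
    rw [integral_sub (int hH.2.1) (int hK), e, sub_self]

/-- A `C¹` function with bounded derivative which equals `s ^ m` on `[0, M]`. -/
theorem exists_lipschitz_extension_rpow {m M : ℝ} (hm : 1 ≤ m) (hM : 0 ≤ M) :
    ∃ (F F' : ℝ → ℝ) (L : ℝ≥0), (∀ s, HasDerivAt F (F' s) s) ∧ Continuous F' ∧
      (∀ s, |F' s| ≤ L) ∧ ∀ s ∈ Icc 0 M, F s = s ^ m ∧ F' s = m * s ^ (m - 1) := by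
  -- The derivative `m s^(m-1)` is frozen outside `[0, M]`; it is continuous because `m ≥ 1`, and
  -- `F` is its primitive.
  set F' : ℝ → ℝ := fun s => m * (max 0 (min s M)) ^ (m - 1) with hF'
  have hc : Continuous F' := by
    refine continuous_const.mul (Continuous.rpow_const (by fun_prop) fun s => Or.inr ?_)
    linarith
  have hcl : ∀ s ∈ Icc 0 M, F' s = m * s ^ (m - 1) := fun s hs => by
    simp only [hF']
    rw [min_eq_left hs.2, max_eq_right hs.1]
  refine ⟨fun s => ∫ r in 0..s, F' r, F', ⟨m * M ^ (m - 1), by positivity⟩,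
    fun s => (hc.integral_hasStrictDerivAt 0 s).hasDerivAt, hc, fun s => ?_,
    fun s hs => ⟨?_, hcl s hs⟩⟩
  · rw [abs_of_nonneg (by simp only [hF']; positivity)]
    change m * _ ≤ m * M ^ (m - 1)
    gcongr
    exact max_le hM (min_le_right _ _)
  · have : ∫ r in 0..s, F' r = ∫ r in 0..s, m * r ^ (m - 1) := by
      refine intervalIntegral.integral_congr fun r hr => hcl r ?_
      rw [uIcc_of_le hs.1] at hr
      exact ⟨hr.1, hr.2.trans hs.2⟩
    simp only [this]
    rw [intervalIntegral.integral_const_mul, integral_rpow (Or.inl (by linarith)), sub_add_cancel,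
      Real.zero_rpow (by linarith), sub_zero]
    field_simp

/-- The weak gradient of `v ^ m * (c * θ)`. -/
theorem MemVZero.weakGradient_rpow_mul_ae_eq [IsFiniteMeasure (volume.restrict Ω)]
    (hΩ : IsOpen Ω) (hp : IsLogHolderExponent Ω p) (h : MemVZero Ω p v g) {m M : ℝ} (hm : 1 ≤ m)
    (hv : ∀ᵐ x ∂(volume.restrict Ω), v x ∈ Icc 0 M) {θ : E n → ℝ} (hθ : IsTest ∞ Ω θ) {c : ℝ}
    {H : E n → E n} (hH : IsWeakGradient Ω (fun x => v x ^ m * (θ x * c)) H) :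
    H =ᵐ[volume.restrict Ω] fun x =>
      c • ((θ x * (m * v x ^ (m - 1))) • g x + v x ^ m • gradient θ x) := by
  -- The sign of `M` is not known when `Ω` is a null set.
  have hM' : ∀ᵐ x ∂(volume.restrict Ω), v x ∈ Icc 0 (max M 0) := by
    filter_upwards [hv] with x hx using ⟨hx.1, hx.2.trans (le_max_left _ _)⟩
  obtain ⟨F, F', L, hF, hF', hL, hFm⟩ := exists_lipschitz_extension_rpow hm (le_max_right M 0)
  have hFd : Differentiable ℝ F := fun s => (hF s).differentiableAt
  have hlip : LipschitzWith L F := lipschitzWith_of_nnnorm_deriv_le hFd fun s => by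
    rw [(hF s).deriv]; exact hL s
  have hvm : AEStronglyMeasurable v (volume.restrict Ω) := h.1.1.aestronglyMeasurable
  obtain ⟨Cθ, hCθ⟩ := hθ.exists_bound
  obtain ⟨Dθ, hDθ⟩ := hθ.exists_gradient_bound
  set K : E n → E n := fun x => c • ((θ x * F' (v x)) • g x + F (v x) • gradient θ x) with hK
  have hKi : Integrable K (volume.restrict Ω) := by
    refine Integrable.smul c (Integrable.add ?_ ?_)
    · refine (h.1.integrable_gradient hΩ hp).bdd_smul (Cθ * L)
        (hθ.1.continuous.aestronglyMeasurable.mul (hF'.comp_aestronglyMeasurable hvm))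
        (Eventually.of_forall fun x => ?_)
      change ‖θ x * F' (v x)‖ ≤ _
      rw [norm_mul]
      have h1 : 0 ≤ Cθ := (abs_nonneg _).trans (hCθ x)
      exact mul_le_mul (hCθ x) (hL _) (norm_nonneg _) h1
    · exact (integrable_comp_of_lipschitzWith h.1.integrable hlip).smul_bdd Dθ
        (continuous_gradient hθ.contDiff_one).aestronglyMeasurable (Eventually.of_forall hDθ)
  have hHK : H =ᵐ[volume.restrict Ω] K := by
    refine hH.ae_eq_of_integral_eq hΩ (IntegrableOn.locallyIntegrableOn hKi) fun ξ hξ => ?_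
    have e := h.setIntegral_comp_mul_smul_gradient hΩ hp hF hF' hL hθ hξ
    have e1 : ∫ x in Ω, (v x ^ m * (θ x * c)) • gradient ξ x =
        c • ∫ x in Ω, (F (v x) * θ x) • gradient ξ x := by
      rw [← integral_smul]
      refine integral_congr_ae ?_
      filter_upwards [hM'] with x hx
      rw [(hFm _ hx).1, smul_smul]
      congr 1; ring
    rw [e1, e, smul_neg, ← integral_smul]
    congr 2
    ext1 x
    simp only [hK]
    rw [smul_comm]
  filter_upwards [hHK, hM'] with x hx hx2
  rw [hx]
  simp only [hK]
  rw [(hFm _ hx2).1, (hFm _ hx2).2]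

end ChainRule

/-! ### The equation on time slices -/

theorem IsTest.mul_time {Ω : Set (E n)} {T : ℝ} {θ : E n → ℝ} {χ : ℝ → ℝ} (hθ : IsTest ∞ Ω θ)
    (hχ : IsTest ∞ (Ioo 0 T) χ) : IsTest ∞ (cylinder Ω T) fun z => θ z.1 * χ z.2 := by
  have hsub : (Function.support fun z : E n × ℝ => θ z.1 * χ z.2) ⊆ tsupport θ ×ˢ tsupport χ := by
    intro z hz
    have := mul_ne_zero_iff.1 hz
    exact ⟨subset_tsupport _ this.1, subset_tsupport _ this.2⟩
  refine ⟨(hθ.1.comp contDiff_fst).mul (hχ.1.comp contDiff_snd),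
    HasCompactSupport.of_support_subset_isCompact (hθ.2.1.isCompact.prod hχ.2.1.isCompact) hsub, ?_⟩
  exact (closure_minimal hsub ((isClosed_tsupport _).prod (isClosed_tsupport _))).trans
    (prod_mono hθ.2.2 hχ.2.2)

theorem restrict_cylinder (Ω : Set (E n)) (T : ℝ) :
    (volume : Measure (E n × ℝ)).restrict (cylinder Ω T) =
      (volume.restrict Ω).prod (volume.restrict (Ioo 0 T)) := by
  rw [cylinder, Measure.prod_restrict, Measure.volume_eq_prod]

/-- The test functions on a bounded set are separable for the `C¹` norm. -/
theorem exists_countable_dense_tests {Ω : Set (E n)} (hb : Bornology.IsBounded Ω) :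
    ∃ D : Set (E n → ℝ), D.Countable ∧ (∀ d ∈ D, IsTest ∞ Ω d) ∧
      ∀ θ, IsTest ∞ Ω θ → ∀ ε > 0, ∃ d ∈ D, ∀ x ∈ Ω,
        |θ x - d x| ≤ ε ∧ ‖gradient θ x - gradient d x‖ ≤ ε := by
  have : CompactSpace (closure Ω) := isCompact_iff_compactSpace.1 hb.isCompact_closure
  -- The map `θ ↦ (θ, Dθ)` sends tests into the separable metric space `C(closure Ω, ℝ × E n)`.
  -- Second countability, unlike separability, passes to the induced topology and then yields the
  -- dense set.
  let J : {θ : E n → ℝ // IsTest ∞ Ω θ} → C(closure Ω, ℝ × E n) := fun θ =>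
    ⟨fun x => (θ.1 x, gradient θ.1 x), (θ.2.1.continuous.comp continuous_subtype_val).prodMk
      ((continuous_gradient θ.2.contDiff_one).comp continuous_subtype_val)⟩
  let _ : TopologicalSpace {θ : E n → ℝ // IsTest ∞ Ω θ} := TopologicalSpace.induced J inferInstance
  have : SecondCountableTopology {θ : E n → ℝ // IsTest ∞ Ω θ} :=
    TopologicalSpace.secondCountableTopology_induced _ _ J
  have hJ : Continuous J := continuous_induced_dom
  obtain ⟨D, hDc, hDd⟩ := TopologicalSpace.exists_countable_dense {θ : E n → ℝ // IsTest ∞ Ω θ}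
  refine ⟨Subtype.val '' D, hDc.image _, ?_, fun θ hθ ε hε => ?_⟩
  · rintro _ ⟨d, -, rfl⟩
    exact d.2
  · obtain ⟨d, hd, hdD⟩ := hDd.inter_open_nonempty _
      (Metric.isOpen_ball.preimage hJ : IsOpen (J ⁻¹' Metric.ball (J ⟨θ, hθ⟩) ε))
      ⟨⟨θ, hθ⟩, Metric.mem_ball_self hε⟩
    refine ⟨d.1, mem_image_of_mem _ hdD, fun x hx => ?_⟩
    have h1 := (ContinuousMap.dist_lt_iff hε).1 hd ⟨x, subset_closure hx⟩
    rw [dist_comm, Prod.dist_eq, max_lt_iff, Real.dist_eq, dist_eq_norm] at h1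
    exact ⟨h1.1.le, h1.2.le⟩

/-- A linear equation in divergence form in the cylinder holds on almost every time slice. -/
theorem ae_slice_eq_zero {Ω : Set (E n)} {T : ℝ} (hΩ : IsOpen Ω) (hb : Bornology.IsBounded Ω)
    {b : E n × ℝ → ℝ} {A : E n × ℝ → E n}
    (hbi : Integrable b ((volume.restrict Ω).prod (volume.restrict (Ioo 0 T))))
    (hA : Integrable A ((volume.restrict Ω).prod (volume.restrict (Ioo 0 T))))
    (h : ∀ θ, IsTest ∞ Ω θ → ∀ χ, IsTest ∞ (Ioo 0 T) χ →
      ∫ z, χ z.2 * (b z * θ z.1 + inner ℝ (A z) (gradient θ z.1))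
        ∂((volume.restrict Ω).prod (volume.restrict (Ioo 0 T))) = 0) :
    ∀ᵐ t ∂(volume.restrict (Ioo 0 T)), ∀ θ, IsTest ∞ Ω θ →
      ∫ x in Ω, (b (x, t) * θ x + inner ℝ (A (x, t)) (gradient θ x)) = 0 := by
  obtain ⟨D, hDc, hDt, hDd⟩ := exists_countable_dense_tests hb
  have single : ∀ θ, IsTest ∞ Ω θ → ∀ᵐ t ∂(volume.restrict (Ioo 0 T)),
      ∫ x in Ω, (b (x, t) * θ x + inner ℝ (A (x, t)) (gradient θ x)) = 0 := by
    intro θ hθ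
    obtain ⟨Cθ, hCθ⟩ := hθ.exists_bound
    obtain ⟨Dθ, hDθ⟩ := hθ.exists_gradient_bound
    have hgθ := continuous_gradient hθ.contDiff_one
    have hi : Integrable (fun z : E n × ℝ => b z * θ z.1 + inner ℝ (A z) (gradient θ z.1))
        ((volume.restrict Ω).prod (volume.restrict (Ioo 0 T))) := by
      refine Integrable.add ?_ ?_
      · exact hbi.mul_bdd (c := Cθ) (hθ.1.continuous.comp continuous_fst).aestronglyMeasurable
          (Eventually.of_forall fun z => hCθ z.1)
      · refine Integrable.mono' (hA.norm.mul_const Dθ)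
          (hA.1.inner (hgθ.comp continuous_fst).aestronglyMeasurable)
          (Eventually.of_forall fun z => ?_)
        refine (norm_inner_le_norm _ _).trans ?_
        gcongr
        exact hDθ _
    have hz := isOpen_Ioo.ae_eq_zero_of_integral_contDiff_smul_eq_zero (μ := volume)
      (f := fun t => ∫ x in Ω, (b (x, t) * θ x + inner ℝ (A (x, t)) (gradient θ x)))
      (IntegrableOn.locallyIntegrableOn hi.integral_prod_right) (fun χ h1 h2 h3 => ?_)
    · rwa [ae_restrict_iff' measurableSet_Ioo]
    · have hχ : IsTest ∞ (Ioo 0 T) χ := ⟨h1, h2, h3⟩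
      obtain ⟨C, hC⟩ := hχ.exists_bound
      have e := h θ hθ χ hχ
      rw [integral_prod_symm _ (hi.bdd_mul (f := fun z => χ z.2) (c := C)
        (h1.continuous.comp continuous_snd).aestronglyMeasurable
        (Eventually.of_forall fun z => hC z.2))] at e
      rw [← setIntegral_eq_integral_of_forall_compl_eq_zero (s := Ioo 0 T)
        (fun x hx => by rw [hχ.eq_zero hx, zero_smul])]
      refine Eq.trans (integral_congr_ae (Eventually.of_forall fun t => ?_)) e
      simp only [smul_eq_mul]
      rw [← integral_const_mul]
  -- The exceptional null set of times depends on the test function; countability of `D` gives one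
  -- null set for all `d ∈ D`, and density extends the identity to every `θ`.
  have hall := (ae_ball_iff hDc).2 fun d hd => single d (hDt d hd)
  filter_upwards [hall, hbi.prod_left_ae, hA.prod_left_ae] with t ht hbt hAt θ hθ
  have int : ∀ θ, IsTest ∞ Ω θ → Integrable (fun x =>
      b (x, t) * θ x + inner ℝ (A (x, t)) (gradient θ x)) (volume.restrict Ω) := by
    intro θ hθ
    obtain ⟨Cθ, hCθ⟩ := hθ.exists_bound
    obtain ⟨Dθ, hDθ⟩ := hθ.exists_gradient_bound
    have hgθ := continuous_gradient hθ.contDiff_one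
    refine Integrable.add ?_ ?_
    · exact hbt.mul_bdd (c := Cθ) hθ.1.continuous.aestronglyMeasurable
        (Eventually.of_forall hCθ)
    · refine Integrable.mono' (hAt.norm.mul_const Dθ) (hAt.1.inner hgθ.aestronglyMeasurable)
        (Eventually.of_forall fun x => (norm_inner_le_norm _ _).trans ?_)
      gcongr
      exact hDθ _
  set I : ℝ := ∫ x in Ω, (‖b (x, t)‖ + ‖A (x, t)‖) with hI
  have hI0 : 0 ≤ I := integral_nonneg fun x => by positivity
  have key : ∀ ε > 0,
      |∫ x in Ω, (b (x, t) * θ x + inner ℝ (A (x, t)) (gradient θ x))| ≤ ε * I := by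
    intro ε hε
    obtain ⟨d, hd, hdist⟩ := hDd θ hθ ε hε
    have e0 := ht d hd
    rw [← sub_zero (∫ x in Ω, (b (x, t) * θ x + inner ℝ (A (x, t)) (gradient θ x))), ← e0,
      ← integral_sub (int θ hθ) (int d (hDt d hd)), ← Real.norm_eq_abs, hI, ← integral_const_mul]
    refine norm_integral_le_of_norm_le ((hbt.norm.add hAt.norm).const_mul ε) ?_
    rw [ae_restrict_iff' hΩ.measurableSet]
    refine Eventually.of_forall fun x hx => ?_
    have e1 : b (x, t) * θ x + inner ℝ (A (x, t)) (gradient θ x) -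
        (b (x, t) * d x + inner ℝ (A (x, t)) (gradient d x)) =
        b (x, t) * (θ x - d x) + inner ℝ (A (x, t)) (gradient θ x - gradient d x) := by
      rw [inner_sub_right]; ring
    rw [e1]
    obtain ⟨h1, h2⟩ := hdist x hx
    calc _ ≤ ‖b (x, t)‖ * |θ x - d x| + ‖A (x, t)‖ * ‖gradient θ x - gradient d x‖ := by
          refine (norm_add_le _ _).trans (add_le_add ?_ (norm_inner_le_norm _ _))
          rw [norm_mul, Real.norm_eq_abs (θ x - d x)]
      _ ≤ ‖b (x, t)‖ * ε + ‖A (x, t)‖ * ε := by gcongr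
      _ = _ := by ring
  have hle : |∫ x in Ω, (b (x, t) * θ x + inner ℝ (A (x, t)) (gradient θ x))| ≤ 0 := by
    refine ge_of_tendsto (x := 𝓝[>] (0 : ℝ)) (f := fun ε => ε * I) ?_ ?_
    · have : Tendsto (fun ε : ℝ => ε * I) (𝓝 0) (𝓝 (0 * I)) := tendsto_id.mul_const I
      rw [zero_mul] at this
      exact this.mono_left nhdsWithin_le_nhds
    · filter_upwards [self_mem_nhdsWithin] with ε hε using key ε hε
  exact abs_eq_zero.1 (le_antisymm hle (abs_nonneg _))

/-! ### Weak solutions on time slices -/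

section Solution

variable {Ω : Set (E n)} {T : ℝ} {p : E n → ℝ} {m : ℝ} {u₀ : E n → ℝ} {u : E n × ℝ → ℝ}
  {G : E n × ℝ → E n} {w : E n × ℝ → ℝ}

theorem IsWeakSolutionWith.exists_upper_bound (hu : IsWeakSolutionWith Ω T p m u₀ u G w) :
    ∃ M, 0 ≤ M ∧ ∀ᵐ z ∂((volume.restrict Ω).prod (volume.restrict (Ioo 0 T))), u z ∈ Icc 0 M := by
  have h1 := hu.nonneg
  have h2 := ae_le_eLpNormEssSup (f := u) (μ := volume.restrict (cylinder Ω T))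
  have h3 := hu.memLinfty.2
  rw [eLpNorm_exponent_top] at h3
  rw [restrict_cylinder] at h1 h2 h3
  refine ⟨(eLpNormEssSup u ((volume.restrict Ω).prod (volume.restrict (Ioo 0 T)))).toReal,
    ENNReal.toReal_nonneg, ?_⟩
  filter_upwards [h1, h2] with z hz hz2
  refine ⟨hz, ?_⟩
  have := ENNReal.toReal_mono h3.ne hz2
  rw [toReal_enorm] at this
  exact (le_abs_self _).trans this

/-- The weak form of the equation on almost every time slice. -/
theorem IsWeakSolutionWith.ae_slice (hΩ : IsOpen Ω) (hb : Bornology.IsBounded Ω)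
    (hp : IsLogHolderExponent Ω p) (hm : 1 ≤ m) (hu : IsWeakSolutionWith Ω T p m u₀ u G w) :
    ∀ᵐ t ∂(volume.restrict (Ioo 0 T)), ∀ θ, IsTest ∞ Ω θ →
      ∫ x in Ω, ((w (x, t) + m * u (x, t) ^ (m - 1) * ‖G (x, t)‖ ^ p x) * θ x +
        inner ℝ ((u (x, t) ^ m * ‖G (x, t)‖ ^ (p x - 2)) • G (x, t)) (gradient θ x)) = 0 := by
  have hfin : IsFiniteMeasure (volume.restrict Ω) :=
    isFiniteMeasure_restrict.2 hb.measure_lt_top.ne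
  have hfin' : IsFiniteMeasure ((volume : Measure ℝ).restrict (Ioo 0 T)) :=
    isFiniteMeasure_restrict.2 measure_Ioo_lt_top.ne
  set π := (volume.restrict Ω).prod ((volume : Measure ℝ).restrict (Ioo 0 T)) with hπ
  obtain ⟨M, hM0, hM⟩ := hu.exists_upper_bound
  obtain ⟨Q, hQ⟩ := hp.exists_bounds hΩ
  have hQ' : ∀ᵐ z ∂π, 1 < p z.1 ∧ p z.1 ≤ Q := Measure.quasiMeasurePreserving_fst.ae hQ
  have hum : AEMeasurable u π := by
    have := hu.memLinfty.aestronglyMeasurable.aemeasurable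
    rwa [restrict_cylinder] at this
  have hGm : AEStronglyMeasurable G π := by
    have := hu.memU.2.1.1
    rwa [restrict_cylinder] at this
  have hGi : Integrable (fun z => ‖G z‖ ^ p z.1) π := by
    have := hu.memU.2.2.2
    rwa [restrict_cylinder] at this
  have hpm : AEMeasurable (fun z : E n × ℝ => p z.1) π := (hp.aemeasurable hΩ).comp_fst
  have hwi : Integrable w π := by
    have := hu.timeDeriv_memL2
    rw [restrict_cylinder] at this
    exact this.integrable (by norm_num)
  have hb1 : Integrable (fun z => m * u z ^ (m - 1) * ‖G z‖ ^ p z.1) π := by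
    refine hGi.bdd_mul (c := m * M ^ (m - 1)) ((hum.pow_const _).const_mul m).aestronglyMeasurable ?_
    filter_upwards [hM] with z hz
    have h0 := hz.1
    rw [Real.norm_of_nonneg (by positivity)]
    gcongr
    exact hz.2
  have hA : Integrable (fun z => (u z ^ m * ‖G z‖ ^ (p z.1 - 2)) • G z) π := by
    refine Integrable.mono' (((integrable_const (1 : ℝ)).add hGi).const_mul (M ^ m))
      ((((hum.pow_const _).mul (hGm.norm.aemeasurable.pow (hpm.sub_const 2)))).aestronglyMeasurable.smul
        hGm) ?_
    filter_upwards [hM, hQ'] with z hz hz2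
    have h0 := hz.1
    rw [norm_smul, Real.norm_of_nonneg (by positivity), mul_assoc]
    have h1 : ‖G z‖ ^ (p z.1 - 2) * ‖G z‖ ≤ 1 + ‖G z‖ ^ p z.1 := by
      rcases eq_or_ne (G z) 0 with h | h
      · rw [h, norm_zero, mul_zero]; positivity
      · rw [← Real.rpow_add_one (norm_pos_iff.2 h).ne',
          show p z.1 - 2 + 1 = p z.1 - 1 by ring]
        exact rpow_sub_one_le_one_add_rpow (norm_nonneg _) hz2.1.le
    simp only [Pi.add_apply]
    gcongr
    exact hz.2
  refine ae_slice_eq_zero hΩ hb (b := fun z => w z + m * u z ^ (m - 1) * ‖G z‖ ^ p z.1)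
    (A := fun z => (u z ^ m * ‖G z‖ ^ (p z.1 - 2)) • G z) (hwi.add hb1) hA fun θ hθ χ hχ => ?_
  obtain ⟨Cθ, hCθ⟩ := hθ.exists_bound
  obtain ⟨Dθ, hDθ⟩ := hθ.exists_gradient_bound
  obtain ⟨Cχ, hCχ⟩ := hχ.exists_bound
  have hgθ := continuous_gradient hθ.contDiff_one
  have htest := hθ.mul_time hχ
  obtain ⟨H, ⟨hHm, hHw⟩, heq⟩ := hu.weakForm _ ⟨htest.1.of_le (by simp), htest.2⟩
  rw [restrict_cylinder] at hHm heq
  -- The weak form supplies only some weak gradient `H` of `u^m θ χ`. By uniqueness on slices it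
  -- agrees a.e. with the product rule expression `H'`.
  set H' : E n × ℝ → E n := fun z =>
    χ z.2 • ((θ z.1 * (m * u z ^ (m - 1))) • G z + u z ^ m • gradient θ z.1) with hH'
  have hθm : AEStronglyMeasurable (fun z : E n × ℝ => θ z.1) π :=
    (hθ.1.continuous.comp continuous_fst).aestronglyMeasurable
  have hχm : AEStronglyMeasurable (fun z : E n × ℝ => χ z.2) π :=
    (hχ.1.continuous.comp continuous_snd).aestronglyMeasurable
  have hgθm : AEStronglyMeasurable (fun z : E n × ℝ => gradient θ z.1) π :=
    (hgθ.comp continuous_fst).aestronglyMeasurable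
  have hH'm : AEStronglyMeasurable H' π :=
    hχm.smul (((hθm.mul ((hum.pow_const _).const_mul m).aestronglyMeasurable).smul hGm).add
      ((hum.pow_const _).aestronglyMeasurable.smul hgθm))
  have hHH' : H =ᵐ[π] H' := by
    refine ae_eq_prod_of_ae_ae_swap hHm hH'm ?_
    filter_upwards [hHw, hu.lateralTrace, ae_ae_swap_of_ae_prod hM] with t h1 h2 h3
    exact h2.weakGradient_rpow_mul_ae_eq hΩ hp hm h3 hθ h1
  have e1 : ∫ z, ‖G z‖ ^ (p z.1 - 2) * inner ℝ (G z) (H z) ∂π =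
      ∫ z, χ z.2 * (m * u z ^ (m - 1) * ‖G z‖ ^ p z.1 * θ z.1 +
        inner ℝ ((u z ^ m * ‖G z‖ ^ (p z.1 - 2)) • G z) (gradient θ z.1)) ∂π := by
    refine integral_congr_ae ?_
    filter_upwards [hHH', hQ'] with z hz hz2
    rw [hz, ← norm_rpow_sub_two_mul_inner_self hz2.1 (G z)]
    simp only [hH', inner_smul_right, inner_add_right, real_inner_smul_left]
    ring
  rw [e1, ← integral_add] at heq
  · refine Eq.trans (integral_congr_ae (Eventually.of_forall fun z => ?_)) heq
    simp only
    ring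
  · exact hwi.mul_bdd (c := Cθ * Cχ) (hθm.mul hχm) (Eventually.of_forall fun z => by
      rw [norm_mul]
      exact mul_le_mul (hCθ _) (hCχ _) (norm_nonneg _) ((abs_nonneg _).trans (hCθ z.1)))
  · refine Integrable.bdd_mul (c := Cχ) ?_ hχm (Eventually.of_forall fun z => hCχ _)
    refine Integrable.add (hb1.mul_bdd (c := Cθ) hθm (Eventually.of_forall fun z => hCθ _)) ?_
    refine Integrable.mono' (hA.norm.mul_const Dθ) (hA.1.inner hgθm)
      (Eventually.of_forall fun z => (norm_inner_le_norm _ _).trans ?_)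
    gcongr
    exact hDθ _

end Solution

/-! ### The energy inequality -/

noncomputable section

/-- The derivative of `s ↦ arsinh (N s)`. -/
def arsinhDeriv (N s : ℝ) : ℝ := N * (√(1 + (N * s) ^ 2))⁻¹

/-- The second derivative of `s ↦ arsinh (N s)`. -/
def arsinhDeriv2 (N s : ℝ) : ℝ := -(N ^ 3 * s * (√(1 + (N * s) ^ 2))⁻¹ ^ 3)

end

theorem sqrt_one_add_sq_pos (a : ℝ) : 0 < √(1 + a ^ 2) := by positivity

theorem hasDerivAt_arsinh_mul (N s : ℝ) :
    HasDerivAt (fun s => Real.arsinh (N * s)) (arsinhDeriv N s) s := by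
  have h := (Real.hasDerivAt_arsinh (N * s)).comp s ((hasDerivAt_id s).const_mul N)
  simpa [arsinhDeriv, mul_comm, Function.comp_def] using h

theorem contDiff_arsinhDeriv (N : ℝ) : ContDiff ℝ ∞ (arsinhDeriv N) := by
  refine contDiff_const.mul (ContDiff.inv (ContDiff.sqrt ?_ fun s => by positivity)
    fun s => (sqrt_one_add_sq_pos _).ne')
  exact contDiff_const.add ((contDiff_const.mul contDiff_id).pow 2)

theorem hasDerivAt_arsinhDeriv (N s : ℝ) :
    HasDerivAt (arsinhDeriv N) (arsinhDeriv2 N s) s := by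
  have h1 : HasDerivAt (fun s => 1 + (N * s) ^ 2) (2 * (N * s) * N) s := by
    have := (((hasDerivAt_id s).const_mul N).pow 2).const_add 1
    simpa using this
  have hpos : (1 : ℝ) + (N * s) ^ 2 ≠ 0 := by positivity
  have h2 := ((h1.sqrt hpos).inv (sqrt_one_add_sq_pos _).ne').const_mul N
  refine h2.congr_deriv ?_
  have := (sqrt_one_add_sq_pos (N * s)).ne'
  rw [arsinhDeriv2]
  field_simp

theorem continuous_arsinhDeriv2 (N : ℝ) : Continuous (arsinhDeriv2 N) := by
  have h : Continuous fun s : ℝ => (√(1 + (N * s) ^ 2))⁻¹ :=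
    Continuous.inv₀ (by fun_prop) fun s => (sqrt_one_add_sq_pos _).ne'
  unfold arsinhDeriv2
  fun_prop

theorem arsinhDeriv_nonneg {N : ℝ} (hN : 0 ≤ N) (s : ℝ) : 0 ≤ arsinhDeriv N s := by
  unfold arsinhDeriv; positivity

theorem inv_sqrt_one_add_sq_le_one (a : ℝ) : (√(1 + a ^ 2))⁻¹ ≤ 1 := by
  refine inv_le_one_of_one_le₀ ?_
  rw [Real.one_le_sqrt]
  nlinarith [sq_nonneg a]

theorem abs_mul_inv_sqrt_one_add_sq_le_one (a : ℝ) : |a * (√(1 + a ^ 2))⁻¹| ≤ 1 := by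
  rw [abs_mul, abs_of_nonneg (inv_nonneg.2 (Real.sqrt_nonneg _)),
    ← div_eq_mul_inv, div_le_one (sqrt_one_add_sq_pos a)]
  exact Real.abs_le_sqrt (by linarith)

theorem abs_arsinhDeriv_le {N : ℝ} (hN : 0 ≤ N) (s : ℝ) : |arsinhDeriv N s| ≤ N := by
  rw [abs_of_nonneg (arsinhDeriv_nonneg hN s)]
  exact mul_le_of_le_one_right hN (inv_sqrt_one_add_sq_le_one _)

/-- Replaces `s * (1/s) = 1`: one power of `v` in `v^m` is absorbed uniformly in `N`. -/
theorem mul_arsinhDeriv_le_one (N s : ℝ) : s * arsinhDeriv N s ≤ 1 := by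
  have := (abs_le.1 (abs_mul_inv_sqrt_one_add_sq_le_one (N * s))).2
  unfold arsinhDeriv
  linarith

theorem mul_arsinhDeriv2 (N s : ℝ) : s * arsinhDeriv2 N s =
    -(arsinhDeriv N s * (N * s * (√(1 + (N * s) ^ 2))⁻¹) ^ 2) := by
  unfold arsinhDeriv arsinhDeriv2; ring

theorem abs_arsinhDeriv2_le {N : ℝ} (s : ℝ) : |arsinhDeriv2 N s| ≤ N ^ 2 := by
  have h : arsinhDeriv2 N s =
      -(N ^ 2 * ((N * s * (√(1 + (N * s) ^ 2))⁻¹) * (√(1 + (N * s) ^ 2))⁻¹ ^ 2)) := by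
    unfold arsinhDeriv2; ring
  rw [h, abs_neg, abs_mul, abs_of_nonneg (sq_nonneg N)]
  refine mul_le_of_le_one_right (sq_nonneg N) ?_
  rw [abs_mul]
  refine mul_le_one₀ (abs_mul_inv_sqrt_one_add_sq_le_one _) (abs_nonneg _) ?_
  rw [abs_of_nonneg (by positivity)]
  exact pow_le_one₀ (by positivity) (inv_sqrt_one_add_sq_le_one _)

/-- Equality would hold for `1/s` in place of `arsinhDeriv N`. With `m ≥ 1` it makes the total
coefficient `m ψ + s ψ'` of `|Dv|^p` nonnegative. -/
theorem neg_arsinhDeriv_le_mul_arsinhDeriv2 {N : ℝ} (hN : 0 ≤ N) (s : ℝ) :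
    -arsinhDeriv N s ≤ s * arsinhDeriv2 N s := by
  rw [mul_arsinhDeriv2, neg_le_neg_iff]
  refine mul_le_of_le_one_right (arsinhDeriv_nonneg hN s) ?_
  exact (sq_le_one_iff_abs_le_one _).2 (abs_mul_inv_sqrt_one_add_sq_le_one _)

/-! ### Testing a time slice with nonlinear functions of the solution -/

section Energy

variable {Ω : Set (E n)} {p : E n → ℝ} {v κ : E n → ℝ} {g : E n → E n}

/-- The support comes from `η` alone, so `ψ 0 ≠ 0` is allowed; indeed `arsinhDeriv N 0 = N`. -/
theorem IsTest.mul_comp {η φ : E n → ℝ} (hη : IsTest ∞ Ω η) {ψ : ℝ → ℝ} (hψ : ContDiff ℝ ∞ ψ)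
    (hφ : IsTest ∞ Ω φ) : IsTest ∞ Ω fun x => η x * ψ (φ x) := by
  have hsub : (Function.support fun x => η x * ψ (φ x)) ⊆ tsupport η := fun x hx =>
    subset_tsupport _ (left_ne_zero_of_mul hx)
  exact ⟨hη.1.mul (hψ.comp hφ.1),
    HasCompactSupport.of_support_subset_isCompact hη.2.1.isCompact hsub,
    (closure_minimal hsub (isClosed_tsupport _)).trans hη.2.2⟩

/-- Testing a slice of the equation with `η ψ(v)`, where `ψ` is smooth, bounded, and has a bounded
derivative. -/
theorem MemVZero.integral_test_comp [IsFiniteMeasure (volume.restrict Ω)] (hΩ : IsOpen Ω)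
    (hp : IsLogHolderExponent Ω p) (h : MemVZero Ω p v g) {m M : ℝ}
    (hv : ∀ᵐ x ∂(volume.restrict Ω), v x ∈ Icc 0 M) {b : E n → ℝ} {A : E n → E n}
    (hb : Integrable b (volume.restrict Ω)) (hA : Integrable A (volume.restrict Ω))
    (hAv : ∀ x, A x = (v x ^ m * ‖g x‖ ^ (p x - 2)) • g x) (hm : 0 ≤ m)
    (heq : ∀ θ, IsTest ∞ Ω θ → ∫ x in Ω, (b x * θ x + inner ℝ (A x) (gradient θ x)) = 0)
    {η : E n → ℝ} (hη : IsTest ∞ Ω η) {ψ ψ' : ℝ → ℝ} (hψ : ContDiff ℝ ∞ ψ)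
    (hψ' : ∀ s, HasDerivAt ψ (ψ' s) s) (hψ'c : Continuous ψ') {C C' : ℝ}
    (hC : ∀ s, |ψ s| ≤ C) (hC' : ∀ s, |ψ' s| ≤ C') :
    (∫ x in Ω, ψ (v x) * (b x * η x + inner ℝ (A x) (gradient η x))) +
      ∫ x in Ω, (η x * v x ^ m * ψ' (v x)) * ‖g x‖ ^ p x = 0 := by
  obtain ⟨φ, hφ, hae, -, -, hgr⟩ := h.exists_approx hΩ hp
  obtain ⟨Cη, hCη⟩ := hη.exists_bound
  obtain ⟨Dη, hDη⟩ := hη.exists_gradient_bound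
  have hgη := continuous_gradient hη.contDiff_one
  have hvm : AEStronglyMeasurable v (volume.restrict Ω) := h.1.1.aestronglyMeasurable
  have hgm := h.1.aestronglyMeasurable_gradient
  have hpm := hp.aemeasurable hΩ
  have hint : Integrable (fun x => b x * η x + inner ℝ (A x) (gradient η x))
      (volume.restrict Ω) := by
    refine Integrable.add (hb.mul_bdd (c := Cη) hη.1.continuous.aestronglyMeasurable
      (Eventually.of_forall hCη)) ?_
    refine Integrable.mono' (hA.norm.mul_const Dη) (hA.1.inner hgη.aestronglyMeasurable)
      (Eventually.of_forall fun x => (norm_inner_le_norm _ _).trans ?_)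
    gcongr
    exact hDη _
  have lim1 : Tendsto (fun k => ∫ x in Ω, ψ (φ k x) • (b x * η x + inner ℝ (A x) (gradient η x)))
      atTop (𝓝 (∫ x in Ω, ψ (v x) • (b x * η x + inner ℝ (A x) (gradient η x)))) := by
    refine tendsto_integral_mul_of_bounded_of_tendsto_L1 (C := C)
      (fun k => (hψ.continuous.comp (hφ k).1.continuous).aestronglyMeasurable)
      (fun k => Eventually.of_forall fun x => hC _) ?_ (fun k => hint.1) hint (by simp)
    filter_upwards [hae] with x hx using (hψ.continuous.tendsto _).comp hx
  have hbd : ∀ᵐ x ∂(volume.restrict Ω), ∀ s, |η x * v x ^ m * ψ' s| ≤ Cη * M ^ m * C' := by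
    filter_upwards [hv] with x hx s
    have h0 := hx.1
    have h1 : 0 ≤ Cη := (abs_nonneg _).trans (hCη x)
    have h2 : 0 ≤ M := h0.trans hx.2
    rw [abs_mul, abs_mul, abs_of_nonneg (by positivity : 0 ≤ v x ^ m)]
    gcongr
    · exact hCη x
    · exact hx.2
    · exact hC' s
  have hmk : ∀ k, AEStronglyMeasurable (fun x => ‖g x‖ ^ (p x - 2) *
      inner ℝ (g x) (gradient (φ k) x)) (volume.restrict Ω) := fun k =>
    (hgm.norm.aemeasurable.pow (hpm.sub_const 2)).aestronglyMeasurable.mul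
      (hgm.inner (continuous_gradient (hφ k).contDiff_one).aestronglyMeasurable)
  have ham : ∀ k, AEStronglyMeasurable (fun x => η x * v x ^ m * ψ' (φ k x))
      (volume.restrict Ω) := fun k =>
    (hη.1.continuous.aestronglyMeasurable.mul
      (hvm.aemeasurable.pow_const m).aestronglyMeasurable).mul
      (hψ'c.comp (hφ k).1.continuous).aestronglyMeasurable
  -- This part comes from the gradient of `ψ (φ k)`. The weighted convergence in
  -- `MemVZero.exists_approx` is made for it: `|g|^(p-2) g · Dφ k → |g|^p` in `L¹`.
  have lim2 : Tendsto (fun k => ∫ x in Ω, (η x * v x ^ m * ψ' (φ k x)) •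
      (‖g x‖ ^ (p x - 2) * inner ℝ (g x) (gradient (φ k) x))) atTop
      (𝓝 (∫ x in Ω, (η x * v x ^ m * ψ' (v x)) • ‖g x‖ ^ p x)) := by
    refine tendsto_integral_mul_of_bounded_of_tendsto_L1 (C := Cη * M ^ m * C') ham
      (fun k => hbd.mono fun x hx => hx _) ?_ hmk h.1.2.2 hgr
    filter_upwards [hae] with x hx
    exact ((hψ'c.tendsto _).comp hx).const_mul _
  -- The slice equation tested with the smooth function `η ψ(φ k)`.
  have hsum : ∀ k, (∫ x in Ω, ψ (φ k x) • (b x * η x + inner ℝ (A x) (gradient η x))) +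
      ∫ x in Ω, (η x * v x ^ m * ψ' (φ k x)) •
        (‖g x‖ ^ (p x - 2) * inner ℝ (g x) (gradient (φ k) x)) = 0 := by
    intro k
    obtain ⟨Dφ, hDφ⟩ := (hφ k).exists_gradient_bound
    have hgφ := continuous_gradient (hφ k).contDiff_one
    rw [← integral_add]
    · refine Eq.trans (integral_congr_ae (Eventually.of_forall fun x => ?_))
        (heq _ (hη.mul_comp hψ (hφ k)))
      have hd := (hφ k).contDiff_one.differentiable one_ne_zero x
      have hψ1 : DifferentiableAt ℝ (fun y => ψ (φ k y)) x :=
        (hψ' _).differentiableAt.comp x hd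
      rw [gradient_mul (hη.contDiff_one.differentiable one_ne_zero x) hψ1, gradient_comp (hψ' _) hd]
      simp only [hAv, smul_eq_mul, inner_add_right, inner_smul_right, real_inner_smul_left]
      ring
    · exact hint.bdd_smul (φ := fun x => ψ (φ k x)) C
        (hψ.continuous.comp (hφ k).1.continuous).aestronglyMeasurable
        (Eventually.of_forall fun x => hC _)
    · have hi : Integrable (fun x => (η x * ψ' (φ k x)) * inner ℝ (A x) (gradient (φ k) x))
          (volume.restrict Ω) := by
        refine Integrable.bdd_mul (c := Cη * C') ?_
          (hη.1.continuous.mul (hψ'c.comp (hφ k).1.continuous)).aestronglyMeasurable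
          (Eventually.of_forall fun x => ?_)
        · refine Integrable.mono' (hA.norm.mul_const Dφ) (hA.1.inner hgφ.aestronglyMeasurable)
            (Eventually.of_forall fun x => (norm_inner_le_norm _ _).trans ?_)
          gcongr
          exact hDφ _
        · rw [norm_mul]
          exact mul_le_mul (hCη _) (hC' _) (norm_nonneg _) ((abs_nonneg _).trans (hCη x))
      refine hi.congr (Eventually.of_forall fun x => ?_)
      simp only [hAv, smul_eq_mul, real_inner_smul_left]
      ring
  have := tendsto_nhds_unique (lim1.add lim2) (by simp only [hsum]; exact tendsto_const_nhds)
  simpa only [smul_eq_mul] using this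

/-- The energy inequality on a time slice; the bound does not depend on `N`. -/
theorem MemVZero.integral_mul_arsinhDeriv_le [IsFiniteMeasure (volume.restrict Ω)] (hΩ : IsOpen Ω)
    (hp : IsLogHolderExponent Ω p) (h : MemVZero Ω p v g) {m M : ℝ} (hm : 1 ≤ m)
    (hv : ∀ᵐ x ∂(volume.restrict Ω), v x ∈ Icc 0 M)
    (hκ : Integrable κ (volume.restrict Ω))
    (heq : ∀ θ, IsTest ∞ Ω θ → ∫ x in Ω, ((κ x + m * v x ^ (m - 1) * ‖g x‖ ^ p x) * θ x +
        inner ℝ ((v x ^ m * ‖g x‖ ^ (p x - 2)) • g x) (gradient θ x)) = 0)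
    {η : E n → ℝ} (hη : IsTest ∞ Ω η) (hη0 : ∀ x, 0 ≤ η x) {D : ℝ}
    (hD : ∀ x, ‖gradient η x‖ ≤ D) {N : ℝ} (hN : 0 ≤ N) :
    ∫ x in Ω, κ x * (η x * arsinhDeriv N (v x)) ≤
      M ^ (m - 1) * D * ∫ x in Ω, (1 + ‖g x‖ ^ p x) := by
  obtain ⟨Q, hQ⟩ := hp.exists_bounds hΩ
  have hvm : AEMeasurable v (volume.restrict Ω) := h.1.1.aestronglyMeasurable.aemeasurable
  have hgm := h.1.aestronglyMeasurable_gradient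
  have hpm := hp.aemeasurable hΩ
  obtain ⟨Cη, hCη⟩ := hη.exists_bound
  have hgη := continuous_gradient hη.contDiff_one
  have hgi : Integrable (fun x => 1 + ‖g x‖ ^ p x) (volume.restrict Ω) :=
    (integrable_const (1 : ℝ)).add h.1.2.2
  have hb1 : Integrable (fun x => m * v x ^ (m - 1) * ‖g x‖ ^ p x) (volume.restrict Ω) := by
    refine h.1.2.2.bdd_mul (c := m * M ^ (m - 1))
      ((hvm.pow_const _).const_mul m).aestronglyMeasurable ?_
    filter_upwards [hv] with x hx
    have h0 := hx.1
    rw [Real.norm_of_nonneg (by positivity)]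
    gcongr
    exact hx.2
  have hAle : ∀ᵐ x ∂(volume.restrict Ω), ‖(v x ^ m * ‖g x‖ ^ (p x - 2)) • g x‖ ≤
      v x ^ m * (1 + ‖g x‖ ^ p x) := by
    filter_upwards [hv, hQ] with x hx hx2
    have h0 := hx.1
    rw [norm_smul, Real.norm_of_nonneg (by positivity), mul_assoc]
    gcongr
    rcases eq_or_ne (g x) 0 with h | h
    · rw [h, norm_zero, mul_zero]; positivity
    · rw [← Real.rpow_add_one (norm_pos_iff.2 h).ne', show p x - 2 + 1 = p x - 1 by ring]
      exact rpow_sub_one_le_one_add_rpow (norm_nonneg _) hx2.1.le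
  have hA : Integrable (fun x => (v x ^ m * ‖g x‖ ^ (p x - 2)) • g x) (volume.restrict Ω) := by
    refine Integrable.mono' (hgi.const_mul (M ^ m))
      (((hvm.pow_const _).mul (hgm.norm.aemeasurable.pow (hpm.sub_const 2))).aestronglyMeasurable.smul
        hgm) ?_
    filter_upwards [hAle, hv] with x hx hx2
    have h0 := hx2.1
    refine hx.trans ?_
    gcongr
    exact hx2.2
  have key := h.integral_test_comp hΩ hp hv (hκ.add hb1) hA (fun _ => rfl) (by linarith) heq hη
    (contDiff_arsinhDeriv N) (hasDerivAt_arsinhDeriv N) (continuous_arsinhDeriv2 N)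
    (abs_arsinhDeriv_le hN) abs_arsinhDeriv2_le
  have hψm : AEStronglyMeasurable (fun x => arsinhDeriv N (v x)) (volume.restrict Ω) :=
    (contDiff_arsinhDeriv N).continuous.comp_aestronglyMeasurable h.1.1.aestronglyMeasurable
  have i1 : Integrable (fun x => arsinhDeriv N (v x) * ((κ x + m * v x ^ (m - 1) * ‖g x‖ ^ p x) *
      η x + inner ℝ ((v x ^ m * ‖g x‖ ^ (p x - 2)) • g x) (gradient η x)))
      (volume.restrict Ω) := by
    refine Integrable.bdd_mul (c := N) (Integrable.add ?_ ?_) hψm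
      (Eventually.of_forall fun x => abs_arsinhDeriv_le hN _)
    · exact (hκ.add hb1).mul_bdd (c := Cη) hη.1.continuous.aestronglyMeasurable
        (Eventually.of_forall hCη)
    · refine Integrable.mono' (hA.norm.mul_const D) (hA.1.inner hgη.aestronglyMeasurable)
        (Eventually.of_forall fun x => (norm_inner_le_norm _ _).trans ?_)
      gcongr
      exact hD _
  have i2 : Integrable (fun x => η x * v x ^ m * arsinhDeriv2 N (v x) * ‖g x‖ ^ p x)
      (volume.restrict Ω) := by
    refine h.1.2.2.bdd_mul (c := Cη * M ^ m * N ^ 2)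
      ((hη.1.continuous.aestronglyMeasurable.mul (hvm.pow_const m).aestronglyMeasurable).mul
        ((continuous_arsinhDeriv2 N).comp_aestronglyMeasurable h.1.1.aestronglyMeasurable)) ?_
    filter_upwards [hv] with x hx
    have h0 := hx.1
    have h1 : 0 ≤ Cη := (abs_nonneg _).trans (hCη x)
    have h2 : 0 ≤ M := h0.trans hx.2
    change ‖η x * v x ^ m * arsinhDeriv2 N (v x)‖ ≤ _
    rw [norm_mul, norm_mul, Real.norm_of_nonneg (by positivity : 0 ≤ v x ^ m)]
    gcongr
    · exact hCη x
    · exact hx.2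
    · exact abs_arsinhDeriv2_le _
  have i3 : Integrable (fun x => κ x * (η x * arsinhDeriv N (v x))) (volume.restrict Ω) := by
    refine hκ.mul_bdd (c := Cη * N) (hη.1.continuous.aestronglyMeasurable.mul hψm)
      (Eventually.of_forall fun x => ?_)
    rw [norm_mul]
    exact mul_le_mul (hCη _) (abs_arsinhDeriv_le hN _) (norm_nonneg _)
      ((abs_nonneg _).trans (hCη x))
  simp only [Pi.add_apply] at key
  rw [← integral_add i1 i2] at key
  -- Subtracting the tested equation, whose integral is zero, cancels the `κ` term and reduces the
  -- claim to a pointwise inequality without time derivative.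
  have hsub := integral_sub i3 (i1.add i2)
  simp only [Pi.add_apply] at hsub
  rw [key, sub_zero] at hsub
  rw [← hsub, ← integral_const_mul]
  refine integral_mono_ae (i3.sub (i1.add i2)) (hgi.const_mul _) ?_
  filter_upwards [hv, hAle] with x hx hAx
  have h0 := hx.1
  have hD0 : 0 ≤ D := (norm_nonneg _).trans (hD x)
  have hψ0 := arsinhDeriv_nonneg hN (v x)
  -- Valid also at `v x = 0`, since the exponent `m` is nonzero.
  have hvm1 : v x ^ m = v x ^ (m - 1) * v x := by
    rw [← Real.rpow_add_one' h0 (by linarith), sub_add_cancel]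
  have hpow : v x ^ (m - 1) ≤ M ^ (m - 1) := Real.rpow_le_rpow h0 hx.2 (by linarith)
  have hpow0 : 0 ≤ v x ^ (m - 1) := by positivity
  have hG0 : 0 ≤ ‖g x‖ ^ p x := by positivity
  have hin : -inner ℝ ((v x ^ m * ‖g x‖ ^ (p x - 2)) • g x) (gradient η x) ≤
      v x ^ m * (1 + ‖g x‖ ^ p x) * D := by
    refine (neg_le_abs _).trans ((abs_real_inner_le_norm _ _).trans ?_)
    exact mul_le_mul hAx (hD x) (norm_nonneg _) (by positivity)
  set J := inner ℝ ((v x ^ m * ‖g x‖ ^ (p x - 2)) • g x) (gradient η x) with hJ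
  have t1 : arsinhDeriv N (v x) * (-J) ≤ M ^ (m - 1) * D * (1 + ‖g x‖ ^ p x) := by
    calc arsinhDeriv N (v x) * (-J)
        ≤ arsinhDeriv N (v x) * (v x ^ m * (1 + ‖g x‖ ^ p x) * D) := by gcongr
      _ = (v x * arsinhDeriv N (v x)) * (v x ^ (m - 1) * D * (1 + ‖g x‖ ^ p x)) := by
          rw [hvm1]; ring
      _ ≤ 1 * (v x ^ (m - 1) * D * (1 + ‖g x‖ ^ p x)) := by
          gcongr
          exact mul_arsinhDeriv_le_one _ _
      _ ≤ _ := by rw [one_mul]; gcongr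
  -- The `|g|^p` terms, from `D(v^m)` and from `Dψ(v)`, together have a favourable sign and are
  -- dropped.
  have t2 : 0 ≤ (η x * (‖g x‖ ^ p x * v x ^ (m - 1))) *
      (m * arsinhDeriv N (v x) + v x * arsinhDeriv2 N (v x)) := by
    have := neg_arsinhDeriv_le_mul_arsinhDeriv2 hN (v x)
    have h3 : 0 ≤ m * arsinhDeriv N (v x) + v x * arsinhDeriv2 N (v x) := by nlinarith
    have := hη0 x
    positivity
  have e : η x * v x ^ m * arsinhDeriv2 N (v x) * ‖g x‖ ^ p x =
      η x * (v x ^ (m - 1) * v x) * arsinhDeriv2 N (v x) * ‖g x‖ ^ p x := by rw [← hvm1]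
  linarith

end Energy

/-! ### The time derivative -/

section Time

variable {X : Type*} [MeasurableSpace X] {μ : Measure X} {T : ℝ} {w : X × ℝ → ℝ}

theorem integrable_prod_Ioo_mono [SFinite μ] {t : ℝ} (ht : t ≤ T) {F : Type*} [NormedAddCommGroup F]
    {f : X × ℝ → F} (hf : Integrable f (μ.prod (volume.restrict (Ioo 0 T)))) :
    Integrable f (μ.prod (volume.restrict (Ioo 0 t))) := by
  refine hf.mono_measure ?_
  have e : ∀ s : ℝ, μ.prod ((volume : Measure ℝ).restrict (Ioo 0 s)) =
      (μ.prod volume).restrict (univ ×ˢ Ioo 0 s) := fun s => by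
    rw [← Measure.prod_restrict, Measure.restrict_univ]
  rw [e, e]
  exact Measure.restrict_mono (prod_mono Subset.rfl (Ioo_subset_Ioo_right ht)) le_rfl

theorem intervalIntegral_eq_integral_Ioo {F : Type*} [NormedAddCommGroup F] [NormedSpace ℝ F]
    {f : ℝ → F} {t : ℝ} (ht : 0 ≤ t) : ∫ r in 0..t, f r = ∫ r in Ioo 0 t, f r := by
  rw [intervalIntegral.integral_of_le ht, integral_Ioc_eq_integral_Ioo]

/-- For a measurable representative of `w`, the primitive is a parameter integral of the indicator
of `{0 < r < t}` times that representative, hence jointly measurable. -/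
theorem aestronglyMeasurable_primitive
    (hw : AEStronglyMeasurable w (μ.prod (volume.restrict (Ioo 0 T)))) :
    AEStronglyMeasurable (fun z : X × ℝ => ∫ r in 0..z.2, w (z.1, r))
      (μ.prod (volume.restrict (Ioo 0 T))) := by
  set w' := hw.mk w with hw'
  have hsm : StronglyMeasurable w' := hw.stronglyMeasurable_mk
  have hind : StronglyMeasurable (fun q : (X × ℝ) × ℝ =>
      {q : (X × ℝ) × ℝ | 0 < q.2 ∧ q.2 < q.1.2}.indicator (fun q => w' (q.1.1, q.2)) q) := by
    refine StronglyMeasurable.indicator (hsm.comp_measurable (by fun_prop)) ?_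
    exact (measurableSet_lt measurable_const measurable_snd).inter
      (measurableSet_lt measurable_snd (by fun_prop))
  refine ⟨_, hind.integral_prod_right' (ν := volume), ?_⟩
  have h1 : ∀ᵐ z ∂(μ.prod ((volume : Measure ℝ).restrict (Ioo 0 T))),
      ∀ᵐ r ∂(volume.restrict (Ioo 0 T)), w (z.1, r) = w' (z.1, r) :=
    Measure.quasiMeasurePreserving_fst.ae (Measure.ae_ae_of_ae_prod hw.ae_eq_mk)
  have h2 : ∀ᵐ z ∂(μ.prod ((volume : Measure ℝ).restrict (Ioo 0 T))), z.2 ∈ Ioo 0 T :=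
    Measure.quasiMeasurePreserving_snd.ae (ae_restrict_mem measurableSet_Ioo)
  filter_upwards [h1, h2] with z hz hz2
  rw [intervalIntegral_eq_integral_Ioo hz2.1.le, ← integral_indicator measurableSet_Ioo]
  refine integral_congr_ae ?_
  rw [ae_restrict_iff' measurableSet_Ioo] at hz
  filter_upwards [hz] with r hr
  by_cases hrt : r ∈ Ioo 0 z.2
  · rw [indicator_of_mem hrt, indicator_of_mem (by exact hrt),
      hr ⟨hrt.1, hrt.2.trans hz2.2⟩]
  · rw [indicator_of_notMem hrt, indicator_of_notMem (by exact hrt)]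

/-- Chain rule for a function whose time derivative is integrable. -/
theorem ae_comp_sub_eq_integral [SFinite μ] {u : X × ℝ → ℝ} {u₀ : X → ℝ}
    (hw : Integrable w (μ.prod (volume.restrict (Ioo 0 T))))
    (hu : AEStronglyMeasurable u (μ.prod (volume.restrict (Ioo 0 T))))
    (hu₀ : AEStronglyMeasurable u₀ μ)
    (h : ∀ᵐ t ∂(volume.restrict (Ioo 0 T)), ∀ᵐ x ∂μ, u (x, t) = u₀ x + ∫ r in 0..t, w (x, r))
    {Ψ ψ : ℝ → ℝ} {K : ℝ≥0} (hΨ : ∀ s, HasDerivAt Ψ (ψ s) s) (hK : LipschitzWith K Ψ) :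
    ∀ᵐ t ∂(volume.restrict (Ioo 0 T)), ∀ᵐ x ∂μ,
      Ψ (u (x, t)) - Ψ (u₀ x) = ∫ s in Ioo 0 t, ψ (u (x, s)) * w (x, s) := by
  -- The hypothesis gives a.e. `x` for a.e. `t`; the chain rule needs a.e. time for a.e. fixed `x`.
  -- The exchange goes through equality a.e. on the product.
  have heq : u =ᵐ[μ.prod (volume.restrict (Ioo 0 T))]
      fun z => u₀ z.1 + ∫ r in 0..z.2, w (z.1, r) :=
    ae_eq_prod_of_ae_ae_swap hu (hu₀.comp_fst.add (aestronglyMeasurable_primitive hw.1)) h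
  have hx := Measure.ae_ae_of_ae_prod heq
  filter_upwards [h, ae_restrict_mem measurableSet_Ioo] with t ht htT
  filter_upwards [ht, hx, hw.prod_right_ae] with x hxt hxs hwx
  have hwi : IntervalIntegrable (fun r => w (x, r)) volume 0 T := by
    rw [intervalIntegrable_iff_integrableOn_Ioo_of_le (htT.1.trans htT.2).le]; exact hwx
  rw [hxt, comp_primitive_sub_eq_integral hwi ⟨htT.1.le, htT.2.le⟩ hΨ hK,
    intervalIntegral_eq_integral_Ioo htT.1.le]
  refine integral_congr_ae ?_
  have := ae_restrict_of_ae_restrict_of_subset (Ioo_subset_Ioo_right htT.2.le) hxs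
  filter_upwards [this] with s hs
  rw [hs]

end Time

/-! ### The weak time derivative and the initial trace -/

section Solution

variable {Ω : Set (E n)} {T : ℝ} {p : E n → ℝ} {m : ℝ} {u₀ : E n → ℝ} {u : E n × ℝ → ℝ}
  {w : E n × ℝ → ℝ}

/-- The continuous representative is a primitive of the weak time derivative. -/
theorem IsWeakTimeDeriv.ae_eq_add_integral (hΩ : IsOpen Ω)
    [IsFiniteMeasure (volume.restrict Ω)] (hT : 0 < T)
    (hw : IsWeakTimeDeriv Ω T u w)
    (hwi : Integrable w ((volume.restrict Ω).prod (volume.restrict (Ioo 0 T))))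
    (hui : Integrable u ((volume.restrict Ω).prod (volume.restrict (Ioo 0 T))))
    (h0 : HasInitialTrace Ω T u u₀) :
    ∀ᵐ t ∂(volume.restrict (Ioo 0 T)), ∀ᵐ x ∂(volume.restrict Ω),
      u (x, t) = u₀ x + ∫ r in 0..t, w (x, r) := by
  obtain ⟨U, hUc, hUu, hU0⟩ := h0
  have hUi : ∀ t, Integrable (U t) (volume.restrict Ω) := fun t =>
    (Lp.memLp (U t)).integrable (by norm_num)
  have hWi : ∀ t ∈ Icc 0 T, Integrable (fun x => ∫ r in 0..t, w (x, r)) (volume.restrict Ω) := by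
    intro t ht
    simp only [intervalIntegral_eq_integral_Ioo ht.1]
    exact (integrable_prod_Ioo_mono ht.2 hwi).integral_prod_left
  -- Pairing with a fixed `θ` reduces the claim to one variable: `t ↦ ∫ θ U t` is continuous and has
  -- weak derivative `∫ θ w`, by testing with `θ(x) χ(t)`.
  have main : ∀ θ, IsTest ∞ Ω θ → ∀ t ∈ Icc 0 T, ∫ x in Ω, θ x * U t x =
      (∫ x in Ω, θ x * U 0 x) + ∫ x in Ω, θ x * ∫ r in 0..t, w (x, r) := by
    intro θ hθ
    obtain ⟨C, hC⟩ := hθ.exists_bound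
    have hθL : MemLp θ 2 (volume.restrict Ω) :=
      (hθ.1.continuous.memLp_of_hasCompactSupport hθ.2.1).restrict Ω
    have hθm : AEStronglyMeasurable (fun z : E n × ℝ => θ z.1)
        ((volume.restrict Ω).prod ((volume : Measure ℝ).restrict (Ioo 0 T))) :=
      (hθ.1.continuous.comp continuous_fst).aestronglyMeasurable
    have hwθ : Integrable (fun z : E n × ℝ => θ z.1 * w z)
        ((volume.restrict Ω).prod (volume.restrict (Ioo 0 T))) :=
      hwi.bdd_mul (c := C) hθm (Eventually.of_forall fun z => hC _)
    have huθ : Integrable (fun z : E n × ℝ => θ z.1 * u z)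
        ((volume.restrict Ω).prod (volume.restrict (Ioo 0 T))) :=
      hui.bdd_mul (c := C) hθm (Eventually.of_forall fun z => hC _)
    have hg : ∀ t, inner ℝ (hθL.toLp θ) (U t) = ∫ x in Ω, θ x * U t x := by
      intro t
      rw [L2.inner_def]
      refine integral_congr_ae ?_
      filter_upwards [hθL.coeFn_toLp] with x hx
      rw [hx]
      simp [mul_comm]
    have hgc : ContinuousOn (fun t => ∫ x in Ω, θ x * U t x) (Icc 0 T) := by
      simp only [← hg]
      exact continuousOn_const.inner hUc
    have hhi : IntegrableOn (fun t => ∫ x in Ω, θ x * w (x, t)) (Ioo 0 T) :=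
      hwθ.integral_prod_right
    have hweak := eq_add_integral_of_weakDeriv hT hgc hhi fun χ hχ => ?_
    · intro t ht
      have e := hweak t ht
      rw [e, intervalIntegral_eq_integral_Ioo ht.1]
      congr 1
      rw [integral_integral_swap (f := fun s x => θ x * w (x, s))
        (integrable_prod_Ioo_mono ht.2 hwθ).swap]
      refine integral_congr_ae (Eventually.of_forall fun x => ?_)
      simp only
      rw [integral_const_mul, intervalIntegral_eq_integral_Ioo ht.1]
    · obtain ⟨C1, hC1⟩ := hχ.exists_bound
      have hdc : Continuous (deriv χ) := hχ.1.continuous_deriv (by simp)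
      obtain ⟨C2, hC2⟩ := hχ.2.1.deriv.exists_bound_of_continuous hdc
      have e := hw.2.2 _ (hθ.mul_time hχ)
      rw [restrict_cylinder] at e
      have e1 : ∀ z : E n × ℝ, u z * deriv (fun s => θ z.1 * χ s) z.2 =
          deriv χ z.2 * (θ z.1 * u z) := fun z => by
        rw [deriv_const_mul _ (hχ.contDiff_one.differentiable one_ne_zero _)]; ring
      have e2 : ∀ z : E n × ℝ, w z * (θ z.1 * χ z.2) = χ z.2 * (θ z.1 * w z) := fun z => by ring
      simp only [e1, e2] at e
      rw [integral_prod_symm _ (huθ.bdd_mul (f := fun z => deriv χ z.2) (c := C2)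
          (hdc.comp continuous_snd).aestronglyMeasurable (Eventually.of_forall fun z => hC2 _)),
        integral_prod_symm _ (hwθ.bdd_mul (f := fun z => χ z.2) (c := C1)
          (hχ.1.continuous.comp continuous_snd).aestronglyMeasurable
          (Eventually.of_forall fun z => hC1 _))] at e
      simp only [integral_const_mul] at e
      have e3 : ∫ t in Ioo 0 T, (∫ x in Ω, θ x * U t x) * deriv χ t =
          ∫ t in Ioo 0 T, deriv χ t * ∫ x in Ω, θ x * u (x, t) := by
        refine integral_congr_ae ?_
        filter_upwards [hUu] with t ht
        rw [mul_comm]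
        congr 1
        refine integral_congr_ae ?_
        filter_upwards [ht] with x hx
        rw [hx]
      rw [e3, e]
      congr 2
      ext t
      ring
  have hall : ∀ t ∈ Icc 0 T, ∀ᵐ x ∂(volume.restrict Ω),
      U t x = U 0 x + ∫ r in 0..t, w (x, r) := by
    intro t ht
    have hz := hΩ.ae_eq_zero_of_integral_contDiff_smul_eq_zero (μ := volume)
      (f := fun x => U t x - (U 0 x + ∫ r in 0..t, w (x, r)))
      (IntegrableOn.locallyIntegrableOn ((hUi t).sub ((hUi 0).add (hWi t ht))))
      (fun θ h1 h2 h3 => ?_)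
    · rw [ae_restrict_iff' hΩ.measurableSet]
      filter_upwards [hz] with x hx hxΩ using sub_eq_zero.1 (hx hxΩ)
    · have hθ : IsTest ∞ Ω θ := ⟨h1, h2, h3⟩
      obtain ⟨C, hC⟩ := hθ.exists_bound
      have int : ∀ {f : E n → ℝ}, Integrable f (volume.restrict Ω) →
          Integrable (fun x => θ x * f x) (volume.restrict Ω) := fun hf =>
        hf.bdd_mul (c := C) h1.continuous.aestronglyMeasurable (Eventually.of_forall hC)
      rw [← setIntegral_eq_integral_of_forall_compl_eq_zero (s := Ω)
        (fun x hx => by rw [hθ.eq_zero hx, zero_smul])]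
      simp only [smul_eq_mul, mul_sub, mul_add]
      have hsub := integral_sub (int (hUi t)) ((int (hUi 0)).add (int (hWi t ht)))
      simp only [Pi.add_apply] at hsub
      rw [hsub, integral_add (int (hUi 0)) (int (hWi t ht)), main θ hθ t ht, sub_self]
  filter_upwards [hUu, ae_restrict_mem measurableSet_Ioo] with t ht htT
  filter_upwards [ht, hall t ⟨htT.1.le, htT.2.le⟩, hU0] with x h1 h2 h3
  rw [← h1, h2, h3]

end Solution

/-! ### Solutions vanish where the initial datum vanishes -/

section Vanishing

variable {Ω : Set (E n)} {T : ℝ} {p : E n → ℝ} {m : ℝ} {u₀ : E n → ℝ} {u : E n × ℝ → ℝ}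
  {G : E n × ℝ → E n} {w : E n × ℝ → ℝ}

theorem lipschitzWith_arsinh_mul (N : ℕ) :
    LipschitzWith N (fun s : ℝ => Real.arsinh (N * s)) :=
  lipschitzWith_of_nnnorm_deriv_le (fun s => (hasDerivAt_arsinh_mul N s).differentiableAt)
    fun s => by
      rw [(hasDerivAt_arsinh_mul N s).deriv, ← NNReal.coe_le_coe]
      simpa using abs_arsinhDeriv_le (Nat.cast_nonneg N) s

/-- The energy bound in the cylinder, uniform in `N`. -/
theorem IsWeakSolutionWith.exists_integral_arsinh_le (hΩ : IsOpen Ω)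
    (hb : Bornology.IsBounded Ω) (hT : 0 < T) (hp : IsLogHolderExponent Ω p) (hm : 1 ≤ m)
    (hu : IsWeakSolutionWith Ω T p m u₀ u G w) {η : E n → ℝ} (hη : IsTest ∞ Ω η)
    (hη0 : ∀ x, 0 ≤ η x) (hηu : ∀ᵐ x ∂(volume.restrict Ω), η x = 0 ∨ u₀ x = 0) :
    ∃ K : ℝ, ∀ᵐ t ∂(volume.restrict (Ioo 0 T)), ∀ N : ℕ,
      Integrable (fun x => η x * Real.arsinh (N * u (x, t))) (volume.restrict Ω) ∧
      ∫ x in Ω, η x * Real.arsinh (N * u (x, t)) ≤ K := by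
  have hfin : IsFiniteMeasure (volume.restrict Ω) :=
    isFiniteMeasure_restrict.2 hb.measure_lt_top.ne
  have hfin' : IsFiniteMeasure ((volume : Measure ℝ).restrict (Ioo 0 T)) :=
    isFiniteMeasure_restrict.2 measure_Ioo_lt_top.ne
  obtain ⟨M, hM0, hM⟩ := hu.exists_upper_bound
  obtain ⟨Cη, hCη⟩ := hη.exists_bound
  obtain ⟨D, hD⟩ := hη.exists_gradient_bound
  have hD0 : 0 ≤ D := (norm_nonneg _).trans (hD 0)
  have hwi : Integrable w ((volume.restrict Ω).prod (volume.restrict (Ioo 0 T))) := by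
    have := hu.timeDeriv_memL2
    rw [restrict_cylinder] at this
    exact this.integrable (by norm_num)
  have hui : Integrable u ((volume.restrict Ω).prod (volume.restrict (Ioo 0 T))) := by
    have := hu.memLinfty
    rw [restrict_cylinder] at this
    exact this.integrable le_top
  have hGi : Integrable (fun z => 1 + ‖G z‖ ^ p z.1)
      ((volume.restrict Ω).prod (volume.restrict (Ioo 0 T))) := by
    have := hu.memU.2.2.2
    rw [restrict_cylinder] at this
    exact (integrable_const (1 : ℝ)).add this
  have hu₀m : AEStronglyMeasurable u₀ (volume.restrict Ω) := by
    obtain ⟨U, -, -, h0⟩ := hu.initialTrace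
    exact (Lp.aestronglyMeasurable (U 0)).congr h0
  have hprim := hu.timeDeriv.ae_eq_add_integral hΩ hT hwi hui hu.initialTrace
  have henergy : ∀ᵐ s ∂(volume.restrict (Ioo 0 T)), ∀ N : ℕ,
      ∫ x in Ω, η x * (arsinhDeriv N (u (x, s)) * w (x, s)) ≤
        M ^ (m - 1) * D * ∫ x in Ω, (1 + ‖G (x, s)‖ ^ p x) := by
    filter_upwards [hu.ae_slice hΩ hb hp hm, hu.lateralTrace, ae_ae_swap_of_ae_prod hM,
      hwi.prod_left_ae] with s h1 h2 h3 h4 N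
    refine le_trans (le_of_eq ?_)
      (h2.integral_mul_arsinhDeriv_le hΩ hp hm h3 h4 h1 hη hη0 hD (Nat.cast_nonneg N))
    refine integral_congr_ae (Eventually.of_forall fun x => ?_)
    simp only
    ring
  -- The slice bounds integrated over all of `(0, T)`, hence independent of both `t` and `N`.
  refine ⟨M ^ (m - 1) * D * ∫ s in Ioo 0 T, ∫ x in Ω, (1 + ‖G (x, s)‖ ^ p x), ?_⟩
  have hchain : ∀ᵐ t ∂(volume.restrict (Ioo 0 T)), ∀ N : ℕ, ∀ᵐ x ∂(volume.restrict Ω),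
      Real.arsinh (N * u (x, t)) - Real.arsinh (N * u₀ x) =
        ∫ s in Ioo 0 t, arsinhDeriv N (u (x, s)) * w (x, s) :=
    ae_all_iff.2 fun N => ae_comp_sub_eq_integral hwi hui.1 hu₀m hprim
      (fun s => hasDerivAt_arsinh_mul N s) (lipschitzWith_arsinh_mul N)
  filter_upwards [hchain, ae_restrict_mem measurableSet_Ioo] with t ht htT N
  have hint : Integrable (fun z : E n × ℝ => η z.1 * (arsinhDeriv N (u z) * w z))
      ((volume.restrict Ω).prod (volume.restrict (Ioo 0 T))) := by
    refine Integrable.bdd_mul (c := Cη) ?_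
      (hη.1.continuous.comp continuous_fst).aestronglyMeasurable
      (Eventually.of_forall fun z => hCη _)
    exact hwi.bdd_mul (c := N)
      ((contDiff_arsinhDeriv N).continuous.comp_aestronglyMeasurable hui.1)
      (Eventually.of_forall fun z => abs_arsinhDeriv_le (Nat.cast_nonneg N) _)
  have hint' := integrable_prod_Ioo_mono htT.2.le hint
  -- The initial contribution `η arsinh (N u₀)` vanishes, because at almost every point `η = 0` or
  -- `u₀ = 0`.
  have heq : (fun x => η x * Real.arsinh (N * u (x, t))) =ᵐ[volume.restrict Ω]
      fun x => ∫ s in Ioo 0 t, η x * (arsinhDeriv N (u (x, s)) * w (x, s)) := by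
    filter_upwards [ht N, hηu] with x hx hx0
    rw [integral_const_mul, ← hx]
    rcases hx0 with h | h
    · simp [h]
    · simp [h]
  refine ⟨hint'.integral_prod_left.congr heq.symm, ?_⟩
  have hmono : ∀ᵐ s ∂(volume.restrict (Ioo 0 t)),
      ∫ x in Ω, η x * (arsinhDeriv N (u (x, s)) * w (x, s)) ≤
        M ^ (m - 1) * D * ∫ x in Ω, (1 + ‖G (x, s)‖ ^ p x) := by
    filter_upwards [ae_restrict_of_ae_restrict_of_subset (Ioo_subset_Ioo_right htT.2.le) henergy]
      with s hs using hs N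
  have hGs : Integrable (fun s => ∫ x in Ω, (1 + ‖G (x, s)‖ ^ p x)) (volume.restrict (Ioo 0 T)) :=
    hGi.integral_prod_right
  calc ∫ x in Ω, η x * Real.arsinh (N * u (x, t))
      = ∫ x in Ω, ∫ s in Ioo 0 t, η x * (arsinhDeriv N (u (x, s)) * w (x, s)) :=
        integral_congr_ae heq
    _ = ∫ s in Ioo 0 t, ∫ x in Ω, η x * (arsinhDeriv N (u (x, s)) * w (x, s)) :=
        integral_integral_swap (f := fun x s => η x * (arsinhDeriv N (u (x, s)) * w (x, s))) hint'
    _ ≤ ∫ s in Ioo 0 t, M ^ (m - 1) * D * ∫ x in Ω, (1 + ‖G (x, s)‖ ^ p x) :=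
        integral_mono_ae hint'.integral_prod_right
          ((hGs.mono_measure (Measure.restrict_mono (Ioo_subset_Ioo_right htT.2.le) le_rfl)).const_mul
            _) hmono
    _ = M ^ (m - 1) * D * ∫ s in Ioo 0 t, ∫ x in Ω, (1 + ‖G (x, s)‖ ^ p x) :=
        integral_const_mul _ _
    _ ≤ _ := by
        refine mul_le_mul_of_nonneg_left (setIntegral_mono_set hGs (Eventually.of_forall fun s => ?_)
          (LE.le.eventuallyLE (Ioo_subset_Ioo_right htT.2.le))) (by positivity)
        exact integral_nonneg fun x => by positivity

/-- Where `η` and `v` are both positive the integrands tend to `∞` with `N`, whereas by Fatou's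
lemma their lower limit has finite integral. -/
theorem ae_not_pos_of_integral_arsinh_le {μ : Measure (E n)} {η v : E n → ℝ} {K : ℝ}
    (hη0 : ∀ x, 0 ≤ η x) (hv : ∀ᵐ x ∂μ, 0 ≤ v x)
    (hi : ∀ N : ℕ, Integrable (fun x => η x * Real.arsinh (N * v x)) μ)
    (hK : ∀ N : ℕ, ∫ x, η x * Real.arsinh (N * v x) ∂μ ≤ K) :
    ∀ᵐ x ∂μ, 0 < η x → ¬ 0 < v x := by
  set f : ℕ → E n → ℝ≥0∞ := fun N x => ENNReal.ofReal (η x * Real.arsinh (N * v x)) with hf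
  have hfm : ∀ N, AEMeasurable (f N) μ := fun N => (hi N).1.aemeasurable.ennreal_ofReal
  have hle : ∫⁻ x, liminf (fun N => f N x) atTop ∂μ ≤ ENNReal.ofReal K := by
    refine (lintegral_liminf_le' hfm).trans ?_
    refine liminf_le_of_frequently_le' (Frequently.of_forall fun N => ?_)
    rw [← ofReal_integral_eq_lintegral_ofReal (hi N)]
    · exact ENNReal.ofReal_le_ofReal (hK N)
    · filter_upwards [hv] with x hx
      exact mul_nonneg (hη0 x) (Real.arsinh_nonneg_iff.2 (by positivity))
  have hlm : AEMeasurable (fun x => liminf (fun N => f N x) atTop) μ := by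
    simp only [liminf_eq_iSup_iInf_of_nat]
    exact AEMeasurable.iSup fun i => AEMeasurable.biInf _ (to_countable _) fun j _ => hfm j
  have hlt := ae_lt_top' hlm (hle.trans_lt ENNReal.ofReal_lt_top).ne
  filter_upwards [hlt] with x hx hηx hvx
  have htend : Tendsto (fun N => f N x) atTop (𝓝 ⊤) := by
    refine ENNReal.tendsto_ofReal_nhds_top.2 ?_
    refine Tendsto.const_mul_atTop hηx ?_
    have h1 : Tendsto (fun N : ℕ => (N : ℝ) * v x) atTop atTop :=
      tendsto_natCast_atTop_atTop.atTop_mul_const hvx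
    exact Real.sinhOrderIso.symm.tendsto_atTop.comp h1
  rw [htend.liminf_eq] at hx
  exact lt_irrefl _ hx

end Vanishing

end PxParabolic

/-! ### The inclusion of supports -/

theorem theorem2 {n : ℕ} (Ω : Set (PxParabolic.E n)) (hΩ : PxParabolic.IsBoundedLipschitzDomain Ω)
    (T : ℝ) (hT : 0 < T)
    (p : PxParabolic.E n → ℝ) (hp : PxParabolic.IsLogHolderExponent Ω p)
    (m : ℝ) (hm : 1 ≤ m)
    (u₀ : PxParabolic.E n → ℝ) (hu₀ : ∀ᵐ x ∂(volume.restrict Ω), 0 ≤ u₀ x)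
    (hsupp : PxParabolic.supp Ω u₀ ⊂ Ω)
    (u : PxParabolic.E n × ℝ → ℝ) (hu : PxParabolic.IsWeakSolution Ω T p m u₀ u) :
    ∀ᵐ t ∂(volume.restrict (Ioc 0 T)),
      PxParabolic.supp Ω (fun x => u (x, t)) ⊆ PxParabolic.supp Ω u₀ := by
  obtain ⟨G, w, hu⟩ := hu
  have hW := PxParabolic.isOpen_diff_supp hΩ.isOpen u₀
  set W := Ω \ PxParabolic.supp Ω u₀ with hWdef
  have hzero : ∀ᵐ x ∂(volume.restrict Ω), x ∈ W → u₀ x = 0 := by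
    filter_upwards [hu₀, ae_restrict_of_ae (PxParabolic.ae_not_pos_of_notMem_supp Ω u₀)]
      with x h1 h2 hx
    exact le_antisymm (not_lt.1 (h2 hx.1 hx.2)) h1
  have hbump : ∀ x : PxParabolic.E n, ∃ η : PxParabolic.E n → ℝ, x ∈ W →
      PxParabolic.IsTest ∞ W η ∧ (∀ y, 0 ≤ η y) ∧ {y | 0 < η y} ∈ 𝓝 x := by
    intro x
    by_cases hx : x ∈ W
    · obtain ⟨ε, hε, hball⟩ := Metric.isOpen_iff.1 hW x hx
      let b : ContDiffBump x := ⟨ε / 4, ε / 2, by positivity, by linarith⟩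
      refine ⟨b, fun _ => ⟨⟨b.contDiff, b.hasCompactSupport, ?_⟩, fun y => b.nonneg, ?_⟩⟩
      · rw [b.tsupport_eq]
        exact (Metric.closedBall_subset_ball (half_lt_self hε)).trans hball
      · filter_upwards [Metric.ball_mem_nhds x b.rOut_pos] with y hy
        exact b.pos_of_mem_ball hy
    · exact ⟨0, fun h => absurd h hx⟩
  choose η hη using hbump
  -- By the Lindelöf property countably many sets `{η x > 0}` cover `W`, so the exceptional times of
  -- the individual cutoffs still form a null set.
  obtain ⟨S, hSW, hSc, hScov⟩ := TopologicalSpace.countable_cover_nhdsWithin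
    (f := fun x => {y | 0 < η x y}) (s := W)
    (fun x hx => mem_nhdsWithin_of_mem_nhds (hη x hx).2.2)
  have hIoo : ∀ᵐ t ∂(volume.restrict (Ioo 0 T)), ∀ x ∈ S,
      ∀ᵐ y ∂(volume.restrict Ω), 0 < η x y → ¬ 0 < u (y, t) := by
    refine (ae_ball_iff hSc).2 fun x hx => ?_
    obtain ⟨hη1, hη2, -⟩ := hη x (hSW hx)
    have hηΩ : PxParabolic.IsTest ∞ Ω (η x) :=
      ⟨hη1.1, hη1.2.1, hη1.2.2.trans sdiff_subset⟩
    obtain ⟨K, hK⟩ := hu.exists_integral_arsinh_le hΩ.isOpen hΩ.isBounded hT hp hm hηΩ hη2 (by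
      filter_upwards [hzero] with y hy
      by_cases hyW : y ∈ W
      · exact Or.inr (hy hyW)
      · exact Or.inl (hη1.eq_zero hyW))
    have hnn := hu.nonneg
    rw [PxParabolic.restrict_cylinder] at hnn
    filter_upwards [hK, PxParabolic.ae_ae_swap_of_ae_prod hnn] with t ht ht2
    exact PxParabolic.ae_not_pos_of_integral_arsinh_le hη2 ht2 (fun N => (ht N).1)
      fun N => (ht N).2
  rw [← Measure.restrict_congr_set Ioo_ae_eq_Ioc]
  filter_upwards [hIoo] with t ht
  refine PxParabolic.supp_subset_supp_of_ae hΩ.isOpen ?_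
  have h1 := (ae_restrict_iff' hΩ.isOpen.measurableSet).1 ((ae_ball_iff hSc).2 ht)
  filter_upwards [h1] with y hy hyW
  obtain ⟨x, hxS, hxy⟩ := mem_iUnion₂.1 (hScov hyW)
  exact hy hyW.1 x hxS hxy
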